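/- Let $n\ge 4$ and $d\ge 1$, and consider pure states of $n$ qudits, i.e. unit vectors $|\psi\rangle\in(\mathbb C^d)^{\otimes n}$ regarded up to a global phase, of parties labelled $A,B,C,D,E_1,\dots,E_{n-4}$. For a set $S$ of parties let $\rho_S(\psi)=\operatorname{Tr}_{\bar S}|\psi\rangle\langle\psi|$ be the marginal on $S$, where $\bar S$ is the complement of $S$. Then almost every $|\psi\rangle$ with respect to the Haar measure (the unitarily invariant probability measure on the unit sphere) is uniquely determined among pure states by its three $(n-2)$-body marginals $$\rho_{ABE_1\dots E_{n-4}},\qquad \rho_{CDE_1\dots E_{n-4}},\qquad \rho_{BDE_1\dots E_{n-4}}:$$ every unit vector $|\varphi\rangle$ having the same three marginals satisfies $|\varphi\rangle=e^{i\theta}|\psi\rangle$ for some $\theta\in\mathbb R$. In particular, almost every $|\psi\rangle$ is $(n-2)$-uniquely determined among pure states ($(n-2)$-UDP): every unit vector $|\varphi\rangle$ with $\rho_S(\varphi)=\rho_S(\psi)$ for all sets $S$ of $n-2$ parties satisfies $|\varphi\rangle=e^{i\theta}|\psi\rangle$ for some $\theta\in\mathbb R$. -/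

import Mathlib

open MeasureTheory

noncomputable section

/-- The Hilbert space `(ℂ^d)^{⊗ n}` of `n` qudits of internal dimension `d`, in the computational
basis: a vector is the family of its amplitudes, indexed by the basis labels `Fin n → Fin d`
(the `p`-th entry of a label is the level of party `p`). -/
abbrev QuditSpace (n d : ℕ) : Type := EuclideanSpace ℂ (Fin n → Fin d)

/-- State vectors (kets) of pure states: the unit vectors of the Hilbert space. -/
abbrev PureState (n d : ℕ) : Type := Metric.sphere (0 : QuditSpace n d) 1

/-- The Haar measure on pure states: the normalized surface measure on the unit sphere (the
unitarily invariant probability measure). The normalization cancels the arbitrary scale of the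
translation-invariant measure on the ambient space. -/
def haarPureState (n d : ℕ) : Measure (PureState n d) :=
  ((Measure.addHaar : Measure (QuditSpace n d)).toSphere Set.univ)⁻¹ •
    (Measure.addHaar : Measure (QuditSpace n d)).toSphere

/-- The basis label of all parties that is `i` on the parties in `S` and `k` on the others. -/
def joinLabel {n d : ℕ} (S : Finset (Fin n))
    (i : {p : Fin n // p ∈ S} → Fin d) (k : {p : Fin n // p ∉ S} → Fin d) : Fin n → Fin d :=
  fun p => if h : p ∈ S then i ⟨p, h⟩ else k ⟨p, h⟩

/-- The marginal of the parties in `S`: the partial trace of `ρ` over all parties outside `S`. -/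
def marginal {n d : ℕ} (S : Finset (Fin n)) (ρ : Matrix (Fin n → Fin d) (Fin n → Fin d) ℂ) :
    Matrix ({p : Fin n // p ∈ S} → Fin d) ({p : Fin n // p ∈ S} → Fin d) ℂ :=
  Matrix.of fun i j => ∑ k : {p : Fin n // p ∉ S} → Fin d, ρ (joinLabel S i k) (joinLabel S j k)

/-- The density matrix `|ψ⟩⟨ψ|`. -/
def density {n d : ℕ} (ψ : PureState n d) : Matrix (Fin n → Fin d) (Fin n → Fin d) ℂ :=
  Matrix.of fun x y => ψ.1 x * star (ψ.1 y)

/-- Two kets describe the same physical state: they agree up to a global phase. -/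
def SamePureState {n d : ℕ} (φ ψ : PureState n d) : Prop :=
  ∃ θ : ℝ, φ.1 = Complex.exp (θ * Complex.I) • ψ.1

/-- `ψ` is uniquely determined among pure states by its marginals on the sets of parties in `F`. -/
def IsDeterminedAmongPureBy {n d : ℕ} (F : Set (Finset (Fin n))) (ψ : PureState n d) : Prop :=
  ∀ φ : PureState n d, (∀ S ∈ F, marginal S (density φ) = marginal S (density ψ)) →
    SamePureState φ ψ

/-- `k`-UDP: `ψ` is uniquely determined among pure states by its `k`-body marginals. -/
def IsUDP {n d : ℕ} (k : ℕ) (ψ : PureState n d) : Prop :=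
  IsDeterminedAmongPureBy {S : Finset (Fin n) | S.card = k} ψ

end

/-! Equal marginals on the complement of `{A, B}` mean that the amplitudes of `φ` and `ψ`, as
families of vectors in the space of `A, B`, have the same Gram matrix. Hence `φ = (V ⊗ 1) ψ` for a
unitary `V` on `A, B`, and the point is that `V` is scalar. Fix the levels of the other parties `E`
and read `ψ` as a matrix `M` from `C, D` to `A, B` (`slice`). The marginal on the complement of `{C,
D}` makes `V` commute with `M M†`; the one on the complement of `{A, C}` gives an equation bilinear
in `V` and `V†`.

These conditions are linearised: the unknowns become the forms `tr (V A) tr (V† B) tr (V C)` and `tr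
(V C)`. Multiplying the bilinear equations, unitarity included, by `tr (V C)` makes them linear and
homogeneous in this pair, and the trilinear form is symmetric in its outer slots. If the only
solution whose linear form vanishes at `1` is zero (`FormPair.IsRigid`), comparison with the
solution for `V = 1` shows that `V` is scalar (`FormPair.IsRigid.eq_smul_one`). Rigidity is
injectivity of a linear system with real-analytic coefficients, so it holds almost everywhere once
it holds at one point (`ae_separating_of_separating`); being scale invariant, it passes to the
sphere.

The one point is `rigidTensor`: a Bell basis on `A, B`, distinct weights, Fourier combinations of
Bell states on `C, D`. Distinct weights leave only the diagonal entries `τ i j k` and `t k` of a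
solution. Fourier analysis of the last marginal shows that `τ i (i + v) k - t k` is, up to explicit
factors, independent of `i`. Evaluating `τ i j k = τ k j i` in two ways on parallelograms then
forces `t` to be constant, hence zero, and `τ` with it. -/

section

/-! ### Genericity: zero sets of analytic functions, and passage to the sphere. -/

open scoped Pointwise

/-- A real-analytic function on a finite-dimensional space that does not vanish at some point
is nonzero almost everywhere. -/
theorem ae_ne_zero_of_analyticOnNhd {E : Type*} [NormedAddCommGroup E] [NormedSpace ℝ E]
    [FiniteDimensional ℝ E] [MeasurableSpace E] [BorelSpace E] (μ : Measure E)
    [μ.IsAddHaarMeasure] {f : E → ℂ} (hf : AnalyticOnNhd ℝ f Set.univ) {x₀ : E}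
    (h₀ : f x₀ ≠ 0) : ∀ᵐ x ∂μ, f x ≠ 0 := by
  have hcont : Continuous f := continuousOn_univ.1 hf.continuousOn
  -- On each line through `x₀` the restriction is analytic and nonzero at `s = 0`, so its zeros are
  -- isolated. Fubini then turns this into a statement for a single dilation `s ≠ 0`.
  have hline : ∀ y : E, ∀ᵐ s : ℝ, f (x₀ + s • y) ≠ 0 := by
    intro y
    have hg : AnalyticOnNhd ℝ (fun s : ℝ => f (x₀ + s • y)) Set.univ := by
      intro s _
      have h1 : AnalyticAt ℝ (fun s : ℝ => x₀ + s • y) s := by fun_prop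
      exact AnalyticAt.fun_comp (hf (x₀ + s • y) trivial) h1
    rcases hg.eqOn_zero_or_eventually_ne_zero_of_preconnected isPreconnected_univ with h | h
    · exact absurd (by simpa using h (Set.mem_univ (0 : ℝ))) h₀
    · have := ae_restrict_le_codiscreteWithin (μ := (volume : Measure ℝ)) MeasurableSet.univ h
      filter_upwards [by simpa using this] with s hs using hs
  have hmeas : MeasurableSet {p : E × ℝ | f (x₀ + p.2 • p.1) ≠ 0} := by
    have : Continuous fun p : E × ℝ => f (x₀ + p.2 • p.1) := by fun_prop
    exact (isOpen_ne.preimage this).measurableSet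
  have hswap : ∀ᵐ s : ℝ, ∀ᵐ y ∂μ, f (x₀ + s • y) ≠ 0 :=
    (Measure.ae_ae_comm hmeas).1 (Filter.Eventually.of_forall hline)
  have hne : ∀ᵐ s : ℝ, s ≠ 0 := by simp [ae_iff]
  obtain ⟨s, hs, hs0⟩ := (hswap.and hne).exists
  have hnull : μ {y | f (x₀ + s • y) = 0} = 0 := by simpa [ae_iff] using hs
  have himg : {x | f x = 0} = (fun y => x₀ + y) '' (s • {y | f (x₀ + s • y) = 0}) := by
    ext x
    simp only [Set.mem_ofPred_eq, Set.mem_image]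
    constructor
    · intro hx
      refine ⟨x - x₀, ?_, by simp⟩
      rw [Set.mem_smul_set_iff_inv_smul_mem₀ hs0]
      simpa [smul_smul, hs0] using hx
    · rintro ⟨y, hy, rfl⟩
      rw [Set.mem_smul_set_iff_inv_smul_mem₀ hs0] at hy
      simpa [smul_smul, hs0] using hy
  rw [ae_iff]
  simp only [not_not]
  rw [himg, Set.image_add_left, measure_preimage_add, Measure.addHaar_smul, hnull, mul_zero]

/-- If a family of linear functionals, depending analytically on a parameter, separates the
points of a finite-dimensional space at one parameter, it does so at almost every parameter. -/
theorem ae_separating_of_separating {E : Type*} [NormedAddCommGroup E] [NormedSpace ℝ E]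
    [FiniteDimensional ℝ E] [MeasurableSpace E] [BorelSpace E] (μ : Measure E)
    [μ.IsAddHaarMeasure] {W : Type*} [AddCommGroup W] [Module ℂ W] [FiniteDimensional ℂ W]
    {J : Type*} (F : E → J → Module.Dual ℂ W)
    (hF : ∀ j w, AnalyticOnNhd ℝ (fun x => F x j w) Set.univ) (x₀ : E)
    (h₀ : ∀ w, (∀ j, F x₀ j w = 0) → w = 0) :
    ∀ᵐ x ∂μ, ∀ w, (∀ j, F x j w = 0) → w = 0 := by
  have hspan : Submodule.span ℂ (Set.range (F x₀)) = ⊤ := by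
    have hbot : (Submodule.span ℂ (Set.range (F x₀))).dualCoannihilator = ⊥ := by
      rw [eq_bot_iff]
      intro w hw
      refine h₀ w fun j => ?_
      exact (Submodule.mem_dualCoannihilator _).1 hw _ (Submodule.subset_span ⟨j, rfl⟩)
    rw [← Subspace.dualCoannihilator_dualAnnihilator_eq
      (W := Submodule.span ℂ (Set.range (F x₀))), hbot, Submodule.dualAnnihilator_bot]
  -- Functionals separating at `x₀` contain a basis of the dual. The determinant of these finitely
  -- many functionals is analytic, and wherever it is nonzero they alone separate.
  obtain ⟨κ, a, -, hκ, hli⟩ := exists_linearIndependent' ℂ (F x₀)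
  have : Fintype κ := FiniteDimensional.fintypeBasisIndex (Module.Basis.mk hli (by rw [hκ, hspan]))
  have hcard : Module.finrank ℂ W = Fintype.card κ := by
    rw [← Subspace.dual_finrank_eq,
      Module.finrank_eq_card_basis (Module.Basis.mk hli (by rw [hκ, hspan]))]
  classical
  let e : Module.Basis κ ℂ W :=
    (Module.finBasisOfFinrankEq ℂ W hcard).reindex (Fintype.equivFin κ).symm
  let M : E → Matrix κ κ ℂ := fun x => Matrix.of fun i j => F x (a i) (e j)
  have hM : ∀ x v i, (M x).mulVec v i = F x (a i) (∑ j, v j • e j) := by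
    intro x v i
    simp [M, Matrix.mulVec, dotProduct, mul_comm]
  have hdet : AnalyticOnNhd ℝ (fun x => (M x).det) Set.univ := by
    simp only [Matrix.det_apply']
    intro x _
    refine Finset.analyticAt_fun_sum _ fun σ _ => ?_
    have := Finset.analyticAt_fun_prod (𝕜 := ℝ) (c := x) Finset.univ
      (f := fun (i : κ) x => M x (σ i) i) fun i _ => hF (a (σ i)) (e i) x trivial
    exact analyticAt_const.mul this
  have hdet₀ : (M x₀).det ≠ 0 := by
    intro h
    obtain ⟨v, hv, hv0⟩ := Matrix.exists_mulVec_eq_zero_iff.2 h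
    apply hv
    have hw : ∑ j, v j • e j = 0 := by
      refine h₀ _ fun j => ?_
      have hj : F x₀ j ∈ Submodule.span ℂ (Set.range (F x₀ ∘ a)) := by
        rw [hκ]; exact Submodule.subset_span ⟨j, rfl⟩
      refine Submodule.span_induction (p := fun g _ => g (∑ j, v j • e j) = 0) ?_ ?_ ?_ ?_ hj
      · rintro _ ⟨i, rfl⟩
        rw [Function.comp_apply, ← hM, hv0]; rfl
      · rfl
      · intro g g' _ _ hg hg'
        rw [LinearMap.add_apply, hg, hg', add_zero]
      · intro c g _ hg
        rw [LinearMap.smul_apply, hg, smul_zero]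
    exact funext fun j => Fintype.linearIndependent_iff.1 e.linearIndependent v hw j
  filter_upwards [ae_ne_zero_of_analyticOnNhd μ hdet hdet₀] with x hx w hw
  by_contra hw0
  apply hx
  refine Matrix.exists_mulVec_eq_zero_iff.1 ⟨e.repr w, ?_, ?_⟩
  · intro h
    exact hw0 (e.repr.map_eq_zero_iff.1 (DFunLike.coe_injective h))
  · funext i
    rw [hM, e.sum_repr, hw]; rfl

/-- In polar coordinates, Fubini shows that almost every direction has a radius at which `p` holds;
`hscale` brings `p` back to radius one. -/
theorem ae_toSphere_of_ae {E : Type*} [NormedAddCommGroup E] [NormedSpace ℝ E]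
    [FiniteDimensional ℝ E] [MeasurableSpace E] [BorelSpace E] (μ : Measure E)
    [μ.IsAddHaarMeasure] {p : E → Prop} (hp : ∀ᵐ x ∂μ, p x)
    (hscale : ∀ (r : ℝ) (x : E), 0 < r → p (r • x) → p x) :
    ∀ᵐ x ∂μ.toSphere, p x.1 := by
  have hsub : ∀ᵐ x ∂μ.comap (Subtype.val : ({0}ᶜ : Set E) → E), p x.1 := by
    rw [← (MeasurableEmbedding.subtype_coe (measurableSet_singleton (0 : E)).compl).ae_map_iff
      (p := p), map_comap_subtype_coe (measurableSet_singleton (0 : E)).compl]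
    exact ae_restrict_of_ae hp
  have hprod := (MeasurePreserving.symm (homeomorphUnitSphereProd E).toMeasurableEquiv
    μ.measurePreserving_homeomorphUnitSphereProd).quasiMeasurePreserving.ae hsub
  filter_upwards [Measure.ae_ae_of_ae_prod hprod] with x hx
  -- An almost-everywhere statement about radii yields an actual radius only because the radial
  -- measure is nonzero.
  have hne : Measure.volumeIoiPow (Module.finrank ℝ E - 1) ≠ 0 := by
    intro h
    have h1 := Measure.volumeIoiPow_apply_Iio (Module.finrank ℝ E - 1) ⟨1, Set.mem_Ioi.2 one_pos⟩
    rw [h] at h1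
    have h2 : (0 : ℝ) < 1 / ((Module.finrank ℝ E - 1 : ℕ) + 1) := by positivity
    simp at h1
    linarith [h1, h2]
  have : (ae (Measure.volumeIoiPow (Module.finrank ℝ E - 1))).NeBot := ae_neBot.2 hne
  obtain ⟨r, hr⟩ := hx.exists
  exact hscale r.1 x.1 r.2 hr

end

/-! ### Unitaries from Gram matrices, and marginals in coordinates. -/

/-- Two families of vectors with the same Gram matrix differ by a unitary. -/
theorem exists_unitary_mul_eq {ι ζ : Type*} [Fintype ι] [DecidableEq ι] [Fintype ζ]
    [DecidableEq ζ] (X Y : Matrix ι ζ ℂ) (h : X.conjTranspose * X = Y.conjTranspose * Y) :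
    ∃ V : Matrix ι ι ℂ, V.conjTranspose * V = 1 ∧ Y = V * X := by
  let f := Matrix.toEuclideanLin X
  let g := Matrix.toEuclideanLin Y
  have hinner : ∀ (Z : Matrix ι ζ ℂ) (v : EuclideanSpace ℂ ζ),
      inner ℂ (Matrix.toEuclideanLin Z v) (Matrix.toEuclideanLin Z v)
        = inner ℂ v (Matrix.toEuclideanLin (Z.conjTranspose * Z) v) := by
    intro Z v
    rw [Matrix.toLpLin_mul_same, LinearMap.comp_apply, Matrix.toEuclideanLin_conjTranspose_eq_adjoint,
      LinearMap.adjoint_inner_right]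
  have hnorm : ∀ v, ‖g v‖ = ‖f v‖ := by
    intro v
    rw [← sq_eq_sq₀ (norm_nonneg _) (norm_nonneg _), ← Complex.ofReal_inj]
    push_cast
    have h1 := inner_self_eq_norm_sq_to_K (𝕜 := ℂ) (g v)
    have h2 := inner_self_eq_norm_sq_to_K (𝕜 := ℂ) (f v)
    simp only [Complex.coe_algebraMap] at h1 h2
    rw [← h1, ← h2, hinner, hinner, h]
  obtain ⟨s, hs⟩ := f.rangeRestrict.exists_rightInverse_of_surjective f.range_rangeRestrict
  have hs' : ∀ w, f (s w) = w := fun w => congrArg Subtype.val (LinearMap.congr_fun hs w)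
  -- The map `f v ↦ g v` is isometric on the range of `f` by `hnorm`, and extends to an isometry of
  -- the whole finite-dimensional space. The section `s` only serves to write it down; `hg` shows
  -- that its choice does not matter.
  let L : LinearMap.range f →ₗᵢ[ℂ] EuclideanSpace ℂ ι :=
    { toLinearMap := g ∘ₗ s
      norm_map' := fun w => by
        change ‖g (s w)‖ = ‖w‖
        rw [hnorm, hs']; rfl }
  have hg : ∀ v, g v = L.extend (f v) := by
    intro v
    have h1 : L.extend ((f.rangeRestrict v : LinearMap.range f) : EuclideanSpace ℂ ι) = L (f.rangeRestrict v) :=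
      L.extend_apply _
    rw [show f v = ((f.rangeRestrict v : LinearMap.range f) : EuclideanSpace ℂ ι) from rfl, h1]
    change g v = g (s _)
    rw [← sub_eq_zero, ← map_sub, ← norm_eq_zero, hnorm, map_sub, hs']
    simp
  refine ⟨Matrix.toEuclideanLin.symm L.extend.toLinearMap, ?_, ?_⟩
  · apply Matrix.toEuclideanLin.injective
    rw [Matrix.toLpLin_mul_same, Matrix.toEuclideanLin_conjTranspose_eq_adjoint,
      LinearEquiv.apply_symm_apply, Matrix.toLpLin_one]
    ext1 v
    refine ext_inner_left ℂ fun w => ?_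
    rw [LinearMap.comp_apply, LinearMap.adjoint_inner_right]
    exact L.extend.inner_map_map w v
  · apply Matrix.toEuclideanLin.injective
    ext1 v
    change g v = _
    rw [hg, Matrix.toLpLin_mul_same, LinearEquiv.apply_symm_apply]
    rfl

/-- The label that agrees with `z` except at the parties `p` and `q`. -/
def setPair {n : ℕ} {X : Type*} (p q : Fin n) (z : Fin n → X) (a b : X) : Fin n → X :=
  Function.update (Function.update z p a) q b

theorem sum_setPair_of_marginal_eq {n d : ℕ} {φ ψ : PureState n d} {p q : Fin n} (hpq : p ≠ q)
    (h : marginal ({p, q} : Finset (Fin n))ᶜ (density φ) = marginal {p, q}ᶜ (density ψ))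
    (z z' : Fin n → Fin d) :
    ∑ x : Fin d × Fin d, φ.1 (setPair p q z x.1 x.2) * star (φ.1 (setPair p q z' x.1 x.2)) =
      ∑ x : Fin d × Fin d, ψ.1 (setPair p q z x.1 x.2) * star (ψ.1 (setPair p q z' x.1 x.2)) := by
  have key : ∀ χ : PureState n d,
      ∑ x : Fin d × Fin d, χ.1 (setPair p q z x.1 x.2) * star (χ.1 (setPair p q z' x.1 x.2)) =
        marginal ({p, q} : Finset (Fin n))ᶜ (density χ) (fun r => z r) (fun r => z' r) := by
    intro χ
    simp only [marginal, density, Matrix.of_apply]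
    have hp : p ∉ ({p, q} : Finset (Fin n))ᶜ := by simp
    have hq : q ∉ ({p, q} : Finset (Fin n))ᶜ := by simp
    have hmem : ∀ r : {r : Fin n // r ∉ ({p, q} : Finset (Fin n))ᶜ}, r.1 = p ∨ r.1 = q := by
      rintro ⟨r, hr⟩
      by_contra hc
      exact hr (by simpa using hc)
    refine Fintype.sum_equiv
      { toFun := fun x r => if r.1 = p then x.1 else x.2
        invFun := fun k => (k ⟨p, hp⟩, k ⟨q, hq⟩)
        left_inv := fun x => by simp [hpq.symm]
        right_inv := fun k => by
          funext r
          obtain ⟨r, hr⟩ := r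
          rcases hmem ⟨r, hr⟩ with h | h <;> simp only at h <;> subst h <;> simp [hpq.symm] }
      _ _ fun x => ?_
    have hl : ∀ y : Fin n → Fin d, setPair p q y x.1 x.2 =
        joinLabel ({p, q} : Finset (Fin n))ᶜ (fun r => y r)
          (fun r => if r.1 = p then x.1 else x.2) := by
      intro y
      funext r
      by_cases h1 : r = q
      · subst h1; simp [setPair, joinLabel, hpq.symm]
      · by_cases h2 : r = p
        · subst h2; simp [setPair, joinLabel, hpq]
        · simp [setPair, joinLabel, h1, h2]
    simp only [Equiv.coe_fn_mk, hl]
  rw [key, key, h]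

/-! ### The linearised constraints and rigidity. -/

/-- Pairs of a trilinear and a linear form on matrices: the unknowns of the linear system that
the unitaries preserving the marginals of a four-party tensor satisfy. -/
abbrev FormPair (ι : Type*) : Type _ :=
  (Matrix ι ι ℂ →ₗ[ℂ] Matrix ι ι ℂ →ₗ[ℂ] Matrix ι ι ℂ →ₗ[ℂ] ℂ) × (Matrix ι ι ℂ →ₗ[ℂ] ℂ)

namespace FormPair

/-- Evaluation of the trilinear form. -/
def evalTri {ι : Type*} (A B C : Matrix ι ι ℂ) : Module.Dual ℂ (FormPair ι) :=
  LinearMap.applyₗ C ∘ₗ LinearMap.applyₗ B ∘ₗ LinearMap.applyₗ A ∘ₗ LinearMap.fst ℂ _ _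

/-- Evaluation of the linear form. -/
def evalLin {ι : Type*} (C : Matrix ι ι ℂ) : Module.Dual ℂ (FormPair ι) :=
  LinearMap.applyₗ C ∘ₗ LinearMap.snd ℂ _ _

@[simp] theorem evalTri_apply {ι : Type*} (A B C : Matrix ι ι ℂ) (w : FormPair ι) :
    evalTri A B C w = w.1 A B C := rfl

@[simp] theorem evalLin_apply {ι : Type*} (C : Matrix ι ι ℂ) (w : FormPair ι) :
    evalLin C w = w.2 C := rfl

/-- The pair `(A, B, C) ↦ tr (V A) tr (V† B) tr (V C)`, `C ↦ tr (V C)`. -/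
def ofMatrix {ι : Type*} [Fintype ι] [DecidableEq ι] (V : Matrix ι ι ℂ) : FormPair ι :=
  let f : Matrix ι ι ℂ →ₗ[ℂ] ℂ := Matrix.traceLinearMap ι ℂ ℂ ∘ₗ LinearMap.mulLeft ℂ V
  let g : Matrix ι ι ℂ →ₗ[ℂ] ℂ :=
    Matrix.traceLinearMap ι ℂ ℂ ∘ₗ LinearMap.mulLeft ℂ V.conjTranspose
  (f.smulRight (g.smulRight f), f)

@[simp] theorem ofMatrix_fst {ι : Type*} [Fintype ι] [DecidableEq ι] (V A B C : Matrix ι ι ℂ) :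
    (ofMatrix V).1 A B C = (V * A).trace * ((V.conjTranspose * B).trace * (V * C).trace) := by
  simp [ofMatrix]

@[simp] theorem ofMatrix_snd {ι : Type*} [Fintype ι] [DecidableEq ι] (V C : Matrix ι ι ℂ) :
    (ofMatrix V).2 C = (V * C).trace := by
  simp [ofMatrix]

/-- Indices of the homogeneous linear constraints. -/
abbrev ConstraintIndex (κ : Type*) : Type _ :=
  let Mat := Matrix (κ × κ) (κ × κ) ℂ
  (Mat × Mat × Mat) ⊕ (Mat × Mat × Mat) ⊕ (Mat × Mat × Mat) ⊕
    ((κ × κ) × (κ × κ) × Mat) ⊕ ((κ × κ) × (κ × κ) × Mat)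

/-- The linear constraints on form pairs given by a four-party tensor `M`, viewed as a matrix from
the last two parties to the first two. In order: commutation with the reduced state of the first
two parties in the first and in the second slot, symmetry in the outer slots, unitarity, and
invariance of the marginal of the second and the fourth party. -/
def constraint {κ : Type*} [Fintype κ] [DecidableEq κ] (M : Matrix (κ × κ) (κ × κ) ℂ) :
    ConstraintIndex κ → Module.Dual ℂ (FormPair (κ × κ)) :=
  Sum.elim (fun j => evalTri (M * M.conjTranspose * j.1 - j.1 * (M * M.conjTranspose)) j.2.1 j.2.2) <|
  Sum.elim (fun j => evalTri j.1 (M * M.conjTranspose * j.2.1 - j.2.1 * (M * M.conjTranspose)) j.2.2) <|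
  Sum.elim (fun j => evalTri j.1 j.2.1 j.2.2 - evalTri j.2.2 j.2.1 j.1) <|
  Sum.elim
    (fun j => ∑ y, evalTri (Matrix.single j.1 y 1) (Matrix.single y j.2.1 1) j.2.2 -
      (if j.1 = j.2.1 then (1 : ℂ) else 0) • evalLin j.2.2)
    (fun j => ∑ a, ∑ c,
      evalTri (Matrix.vecMulVec (fun x => M x (c, j.2.1.1)) (Pi.single (a, j.1.1) 1))
        (Matrix.vecMulVec (Pi.single (a, j.1.2) 1) (fun x => star (M x (c, j.2.1.2)))) j.2.2 -
      (∑ a, ∑ c, M (a, j.1.1) (c, j.2.1.1) * star (M (a, j.1.2) (c, j.2.1.2))) • evalLin j.2.2)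

/-- The tensor `M` only admits trivial solutions of its linear constraints. -/
def IsRigid {κ : Type*} [Fintype κ] [DecidableEq κ] (M : Matrix (κ × κ) (κ × κ) ℂ) : Prop :=
  ∀ w : FormPair (κ × κ), (∀ j, constraint M j w = 0) → w.2 1 = 0 → w = 0

theorem constraint_ofMatrix {κ : Type*} [Fintype κ] [DecidableEq κ]
    {M V : Matrix (κ × κ) (κ × κ) ℂ} (hV : V.conjTranspose * V = 1)
    (hP : V * (M * M.conjTranspose) = M * M.conjTranspose * V)
    (hM : ∀ b b' e e', ∑ a, ∑ c, (V * M) (a, b) (c, e) * star ((V * M) (a, b') (c, e')) =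
      ∑ a, ∑ c, M (a, b) (c, e) * star (M (a, b') (c, e'))) (j : ConstraintIndex κ) :
    constraint M j (ofMatrix V) = 0 := by
  rcases j with ⟨A, B, C⟩ | ⟨A, B, C⟩ | ⟨A, B, C⟩ | ⟨x, z, C⟩ | ⟨⟨b, b'⟩, ⟨e, e'⟩, C⟩
  · simp only [constraint, Sum.elim_inl, evalTri_apply, ofMatrix_fst]
    have : (V * (M * M.conjTranspose * A - A * (M * M.conjTranspose))).trace = 0 := by
      rw [mul_sub, Matrix.trace_sub, ← mul_assoc, hP, ← mul_assoc V A, Matrix.trace_mul_comm (V * A),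
        mul_assoc _ V A, sub_self]
    rw [this, zero_mul]
  · simp only [constraint, Sum.elim_inl, Sum.elim_inr, evalTri_apply, ofMatrix_fst]
    have hP' : V.conjTranspose * (M * M.conjTranspose) = M * M.conjTranspose * V.conjTranspose := by
      have := congrArg Matrix.conjTranspose hP
      simpa [Matrix.conjTranspose_mul, mul_assoc] using this.symm
    have : (V.conjTranspose * (M * M.conjTranspose * B - B * (M * M.conjTranspose))).trace = 0 := by
      rw [mul_sub, Matrix.trace_sub, ← mul_assoc, hP', ← mul_assoc V.conjTranspose B,
        Matrix.trace_mul_comm (V.conjTranspose * B), mul_assoc _ V.conjTranspose B, sub_self]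
    rw [this, zero_mul, mul_zero]
  · simp only [constraint, Sum.elim_inl, Sum.elim_inr, evalTri_apply, ofMatrix_fst,
      LinearMap.sub_apply]
    ring
  · simp only [constraint, Sum.elim_inl, Sum.elim_inr, evalTri_apply, ofMatrix_fst,
      LinearMap.sub_apply, LinearMap.sum_apply, LinearMap.smul_apply, evalLin_apply, ofMatrix_snd]
    have h1 := congrFun (congrFun hV z) x
    simp only [Matrix.mul_apply, Matrix.one_apply] at h1
    simp only [Matrix.trace_mul_single, MulOpposite.op_one, one_smul, ← mul_assoc, ← Finset.sum_mul, smul_eq_mul,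
      eq_comm (a := x)]
    rw [← h1, sub_eq_zero]
    congr 1
    exact Finset.sum_congr rfl fun y _ => by ring
  · simp only [constraint, Sum.elim_inr, evalTri_apply, ofMatrix_fst,
      LinearMap.sub_apply, LinearMap.sum_apply, LinearMap.smul_apply, evalLin_apply, ofMatrix_snd]
    rw [← hM, smul_eq_mul, sub_eq_zero, Finset.sum_mul]
    refine Finset.sum_congr rfl fun a _ => ?_
    rw [Finset.sum_mul]
    refine Finset.sum_congr rfl fun c _ => ?_
    rw [← mul_assoc]
    congr 2
    · simp [Matrix.mul_vecMulVec, Matrix.trace_vecMulVec, Matrix.mulVec, dotProduct,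
        Matrix.mul_apply, Pi.single_apply]
    · simp [Matrix.mul_vecMulVec, Matrix.trace_vecMulVec, dotProduct, Matrix.mul_apply]

theorem IsRigid.eq_smul_one {κ : Type*} [Fintype κ] [DecidableEq κ] [Nonempty κ]
    {M V : Matrix (κ × κ) (κ × κ) ℂ} (hR : IsRigid M) (hV : V.conjTranspose * V = 1)
    (hP : V * (M * M.conjTranspose) = M * M.conjTranspose * V)
    (hM : ∀ b b' e e', ∑ a, ∑ c, (V * M) (a, b) (c, e) * star ((V * M) (a, b') (c, e')) =
      ∑ a, ∑ c, M (a, b) (c, e) * star (M (a, b') (c, e'))) : ∃ c : ℂ, V = c • 1 := by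
  -- With this `c`, the linear form of `ofMatrix V - c • ofMatrix 1` vanishes at the identity, as
  -- `IsRigid` requires.
  set c : ℂ := V.trace / (Fintype.card (κ × κ) : ℂ) with hc
  have hw := hR (ofMatrix V + (-c) • ofMatrix 1) (fun j => by
      rw [LinearMap.map_add]
      rw [LinearMap.map_smul, constraint_ofMatrix hV hP hM,
        constraint_ofMatrix (by simp) (by simp) (by simp), smul_zero, add_zero]) (by
      have : (Fintype.card (κ × κ) : ℂ) ≠ 0 := by simp [Fintype.card_ne_zero]
      simp [hc])
  refine ⟨c, ?_⟩
  ext x y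
  have h2 := LinearMap.congr_fun (congrArg Prod.snd hw) (Matrix.single y x 1)
  rcases eq_or_ne x y with rfl | hxy
  · simpa [← sub_eq_add_neg, sub_eq_zero, Matrix.trace_mul_single] using h2
  · simpa [← sub_eq_add_neg, sub_eq_zero, Matrix.trace_mul_single, hxy, hxy.symm] using h2

theorem analyticAt_apply₃ {ι E : Type*} [Fintype ι] [DecidableEq ι] [NormedAddCommGroup E]
    [NormedSpace ℝ E] {A B : E → Matrix ι ι ℂ} {ψ : E}
    (hA : ∀ x y, AnalyticAt ℝ (fun ψ => A ψ x y) ψ) (hB : ∀ x y, AnalyticAt ℝ (fun ψ => B ψ x y) ψ)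
    (C : Matrix ι ι ℂ) (w : FormPair ι) : AnalyticAt ℝ (fun ψ => w.1 (A ψ) (B ψ) C) ψ := by
  have h : (fun ψ => w.1 (A ψ) (B ψ) C) = fun ψ => ∑ x, ∑ y, ∑ z, ∑ u,
      A ψ x y * (B ψ z u * w.1 (Matrix.single x y 1) (Matrix.single z u 1) C) := by
    funext ψ
    have hs : ∀ (X : Matrix ι ι ℂ) (x y : ι), Matrix.single x y (X x y) = X x y • Matrix.single x y 1 := by
      intro X x y; simp [Matrix.smul_single]
    conv_lhs => rw [Matrix.matrix_eq_sum_single (A ψ)]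
    simp only [hs, map_sum, LinearMap.sum_apply, map_smul, LinearMap.smul_apply, smul_eq_mul]
    refine Finset.sum_congr rfl fun x _ => Finset.sum_congr rfl fun y _ => ?_
    conv_lhs => rw [Matrix.matrix_eq_sum_single (B ψ)]
    simp only [hs, map_sum, LinearMap.sum_apply, map_smul, LinearMap.smul_apply, smul_eq_mul,
      Finset.mul_sum]
  rw [h]
  refine Finset.analyticAt_fun_sum _ fun x _ => Finset.analyticAt_fun_sum _ fun y _ =>
    Finset.analyticAt_fun_sum _ fun z _ => Finset.analyticAt_fun_sum _ fun u _ => ?_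
  exact (hA x y).mul ((hB z u).mul analyticAt_const)

/-- The constraints are polynomial in the entries of `M` and their conjugates, hence analytic over
`ℝ` though not holomorphic. -/
theorem analyticAt_constraint {κ E : Type*} [Fintype κ] [DecidableEq κ] [NormedAddCommGroup E]
    [NormedSpace ℝ E] {M : E → Matrix (κ × κ) (κ × κ) ℂ} {ψ : E}
    (hM : ∀ x y, AnalyticAt ℝ (fun ψ => M ψ x y) ψ) (j : ConstraintIndex κ)
    (w : FormPair (κ × κ)) : AnalyticAt ℝ (fun ψ => constraint (M ψ) j w) ψ := by
  have hS : ∀ x y, AnalyticAt ℝ (fun ψ => star (M ψ x y)) ψ := fun x y =>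
    (Complex.conjCLE.toContinuousLinearMap.analyticAt _).fun_comp (hM x y)
  have hP : ∀ x y, AnalyticAt ℝ (fun ψ => (M ψ * (M ψ).conjTranspose) x y) ψ := by
    intro x y
    simp only [Matrix.mul_apply, Matrix.conjTranspose_apply]
    exact Finset.analyticAt_fun_sum _ fun z _ => (hM x z).mul (hS y z)
  have hcomm : ∀ (A : Matrix (κ × κ) (κ × κ) ℂ) x y, AnalyticAt ℝ (fun ψ =>
      (M ψ * (M ψ).conjTranspose * A - A * (M ψ * (M ψ).conjTranspose)) x y) ψ := by
    intro A x y
    simp only [Matrix.sub_apply, Matrix.mul_apply (N := A), Matrix.mul_apply (M := A)]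
    exact (Finset.analyticAt_fun_sum _ fun z _ => (hP x z).mul analyticAt_const).sub
      (Finset.analyticAt_fun_sum _ fun z _ => analyticAt_const.mul (hP z y))
  rcases j with ⟨A, B, C⟩ | ⟨A, B, C⟩ | ⟨A, B, C⟩ | ⟨x, z, C⟩ | ⟨⟨b, b'⟩, ⟨e, e'⟩, C⟩
  · exact analyticAt_apply₃ (B := fun _ => B) (hcomm A) (fun _ _ => analyticAt_const) C w
  · exact analyticAt_apply₃ (A := fun _ => A) (fun _ _ => analyticAt_const) (hcomm B) C w
  · exact analyticAt_const
  · exact analyticAt_const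
  · simp only [constraint, Sum.elim_inr, LinearMap.sub_apply, LinearMap.sum_apply,
      LinearMap.smul_apply, evalTri_apply]
    refine .sub (Finset.analyticAt_fun_sum _ fun a _ => Finset.analyticAt_fun_sum _ fun c _ => ?_)
      (.smul (Finset.analyticAt_fun_sum _ fun a _ => Finset.analyticAt_fun_sum _ fun c _ =>
        (hM _ _).mul (hS _ _)) analyticAt_const)
    refine analyticAt_apply₃ (fun x y => ?_) (fun x y => ?_) C w
    · simp only [Matrix.vecMulVec_apply]
      exact (hM _ _).mul analyticAt_const
    · simp only [Matrix.vecMulVec_apply]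
      exact analyticAt_const.mul (hS _ _)

/-! ### Solutions of the constraints in a Schmidt basis. -/

/-- The matrix unit at `(i, j)` in the basis given by the columns of `S`. -/
def basisUnit {ι : Type*} [Fintype ι] [DecidableEq ι] (S : Matrix ι ι ℂ) (i j : ι) :
    Matrix ι ι ℂ :=
  S * Matrix.single i j 1 * S.conjTranspose

section

variable {ι : Type*} [Fintype ι] [DecidableEq ι] {S : Matrix ι ι ℂ}

theorem eq_sum_basisUnit (hS : S * S.conjTranspose = 1) (A : Matrix ι ι ℂ) :
    A = ∑ i, ∑ j, (S.conjTranspose * A * S) i j • basisUnit S i j := by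
  have h : A = S * (S.conjTranspose * A * S) * S.conjTranspose := by
    have : S * (S.conjTranspose * A * S) * S.conjTranspose =
      (S * S.conjTranspose) * A * (S * S.conjTranspose) := by simp only [mul_assoc]
    rw [this, hS, one_mul, mul_one]
  conv_lhs => rw [h, Matrix.matrix_eq_sum_single (S.conjTranspose * A * S)]
  simp only [Matrix.mul_sum, Matrix.sum_mul, basisUnit]
  refine Finset.sum_congr rfl fun i _ => Finset.sum_congr rfl fun j _ => ?_
  rw [← Matrix.smul_mul, ← Matrix.mul_smul, Matrix.smul_single, smul_eq_mul, mul_one]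

theorem apply_eq_sum_diag (hS : S * S.conjTranspose = 1) {V : Type*} [AddCommGroup V]
    [Module ℂ V] (f : Matrix ι ι ℂ →ₗ[ℂ] V) (hf : ∀ i j, i ≠ j → f (basisUnit S i j) = 0)
    (A : Matrix ι ι ℂ) : f A = ∑ i, (S.conjTranspose * A * S) i i • f (basisUnit S i i) := by
  conv_lhs => rw [eq_sum_basisUnit hS A]
  simp only [map_sum, map_smul]
  refine Finset.sum_congr rfl fun i _ => Finset.sum_eq_single i (fun j _ hj => ?_) (by simp)
  rw [hf i j hj.symm, smul_zero]

/-- The commutator of `S diag(p) S†` with the matrix unit at `(i, j)` is `p i - p j` times that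
unit, so a map killing all such commutators kills the off-diagonal units when the `p i` are
distinct. -/
theorem apply_basisUnit_eq_zero (hS : S.conjTranspose * S = 1) {p : ι → ℂ}
    (hp : Function.Injective p) {V : Type*} [AddCommGroup V] [Module ℂ V]
    (f : Matrix ι ι ℂ →ₗ[ℂ] V)
    (hf : ∀ A, f (S * Matrix.diagonal p * S.conjTranspose * A -
      A * (S * Matrix.diagonal p * S.conjTranspose)) = 0) {i j : ι} (hij : i ≠ j) :
    f (basisUnit S i j) = 0 := by
  have hd : Matrix.diagonal p * Matrix.single i j (1 : ℂ) = Matrix.single i j (p i) := by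
    ext x y
    by_cases hx : i = x
    · subst hx; simp [Matrix.diagonal_mul, Matrix.single_apply]
    · simp [Matrix.diagonal_mul, hx]
  have hd' : Matrix.single i j (1 : ℂ) * Matrix.diagonal p = Matrix.single i j (p j) := by
    ext x y
    by_cases hy : j = y
    · subst hy; simp [Matrix.mul_diagonal, Matrix.single_apply]
    · simp [Matrix.mul_diagonal, hy]
  have h1 : S * Matrix.diagonal p * S.conjTranspose * basisUnit S i j = p i • basisUnit S i j := by
    have : S * Matrix.diagonal p * S.conjTranspose * basisUnit S i j =
      S * (Matrix.diagonal p * ((S.conjTranspose * S) * Matrix.single i j 1)) * S.conjTranspose := by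
      simp only [basisUnit, mul_assoc]
    rw [this, hS, one_mul, hd, basisUnit, ← Matrix.smul_mul,
      ← Matrix.mul_smul, Matrix.smul_single, smul_eq_mul, mul_one]
  have h2 : basisUnit S i j * (S * Matrix.diagonal p * S.conjTranspose) = p j • basisUnit S i j := by
    have : basisUnit S i j * (S * Matrix.diagonal p * S.conjTranspose) =
      S * (Matrix.single i j 1 * (S.conjTranspose * S) * Matrix.diagonal p) * S.conjTranspose := by
      simp only [basisUnit, mul_assoc]
    rw [this, hS, mul_one, hd', basisUnit, ← Matrix.smul_mul,
      ← Matrix.mul_smul, Matrix.smul_single, smul_eq_mul, mul_one]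
  have h := hf (basisUnit S i j)
  rw [h1, h2, ← sub_smul, map_smul] at h
  exact (smul_eq_zero.1 h).resolve_left (sub_ne_zero.2 fun h => hij (hp h))

end

section

variable {κ : Type*} [Fintype κ] [DecidableEq κ] {S Γ M : Matrix (κ × κ) (κ × κ) ℂ}
  {m : κ × κ → ℂ} {N : ℂ} {w : FormPair (κ × κ)}

/-- The components of a solution in a Schmidt basis of the tensor. -/
def schmidtTri (S : Matrix (κ × κ) (κ × κ) ℂ) (w : FormPair (κ × κ)) (i j k : κ × κ) : ℂ :=
  w.1 (basisUnit S i i) (basisUnit S j j) (basisUnit S k k)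

/-- The components of the linear form of a solution in a Schmidt basis of the tensor. -/
def schmidtLin (S : Matrix (κ × κ) (κ × κ) ℂ) (w : FormPair (κ × κ)) (k : κ × κ) : ℂ :=
  w.2 (basisUnit S k k)

/-- `M` is the product of a unitary, a diagonal matrix and a multiple of a unitary, with distinct
singular values. -/
structure IsSchmidt (S Γ M : Matrix (κ × κ) (κ × κ) ℂ) (m : κ × κ → ℂ) (N : ℂ) : Prop where
  unitary : S.conjTranspose * S = 1
  orthogonal : Γ * Γ.conjTranspose = N • 1
  eq_mul : M = S * Matrix.diagonal m * Γ
  injective : Function.Injective fun i => N * (m i * star (m i))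

theorem IsSchmidt.unitary' (h : IsSchmidt S Γ M m N) : S * S.conjTranspose = 1 :=
  mul_eq_one_comm.1 h.unitary

theorem IsSchmidt.mul_conjTranspose (h : IsSchmidt S Γ M m N) : M * M.conjTranspose =
    S * Matrix.diagonal (fun i => N * (m i * star (m i))) * S.conjTranspose := by
  have : M * M.conjTranspose = S * (Matrix.diagonal m * (Γ * Γ.conjTranspose) *
      Matrix.diagonal (star m)) * S.conjTranspose := by
    rw [h.eq_mul]
    simp only [Matrix.conjTranspose_mul, Matrix.diagonal_conjTranspose, mul_assoc]
  rw [this, h.orthogonal]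
  congr 2
  simp [Matrix.diagonal_mul_diagonal, ← Matrix.diagonal_smul, mul_assoc]

theorem IsSchmidt.fst_basisUnit (h : IsSchmidt S Γ M m N) (hw : ∀ j, constraint M j w = 0)
    {i j : κ × κ} (hij : i ≠ j) : w.1 (basisUnit S i j) = 0 := by
  refine apply_basisUnit_eq_zero h.unitary h.injective _ (fun A => ?_) hij
  refine LinearMap.ext fun B => LinearMap.ext fun C => ?_
  rw [← h.mul_conjTranspose]
  exact hw (Sum.inl (A, B, C))

theorem IsSchmidt.snd_basisUnit (h : IsSchmidt S Γ M m N) (hw : ∀ j, constraint M j w = 0)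
    (A : Matrix (κ × κ) (κ × κ) ℂ) {i j : κ × κ} (hij : i ≠ j) :
    w.1 A (basisUnit S i j) = 0 := by
  refine apply_basisUnit_eq_zero h.unitary h.injective _ (fun B => ?_) hij
  refine LinearMap.ext fun C => ?_
  rw [← h.mul_conjTranspose]
  exact hw (Sum.inr <| Sum.inl (A, B, C))

theorem IsSchmidt.tri_comm (hw : ∀ j, constraint M j w = 0) (A B C : Matrix (κ × κ) (κ × κ) ℂ) :
    w.1 A B C = w.1 C B A :=
  sub_eq_zero.1 (hw (Sum.inr <| Sum.inr <| Sum.inl (A, B, C)))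

theorem IsSchmidt.fst_eq (h : IsSchmidt S Γ M m N) (hw : ∀ j, constraint M j w = 0)
    (A B C : Matrix (κ × κ) (κ × κ) ℂ) : w.1 A B C = ∑ i, ∑ j, (S.conjTranspose * A * S) i i *
      (S.conjTranspose * B * S) j j * w.1 (basisUnit S i i) (basisUnit S j j) C := by
  rw [apply_eq_sum_diag h.unitary' w.1 (fun i j => h.fst_basisUnit hw) A]
  simp only [LinearMap.sum_apply, LinearMap.smul_apply]
  refine Finset.sum_congr rfl fun i _ => ?_
  rw [apply_eq_sum_diag h.unitary' (w.1 _) (fun i j => h.snd_basisUnit hw _) B]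
  simp only [LinearMap.sum_apply, LinearMap.smul_apply, smul_eq_mul, Finset.mul_sum, mul_assoc]

omit [DecidableEq κ] in
theorem conj_vecMulVec (u v : κ × κ → ℂ) (i : κ × κ) :
    (S.conjTranspose * Matrix.vecMulVec u v * S) i i =
      (∑ x, star (S x i) * u x) * ∑ y, v y * S y i := by
  rw [Matrix.mul_vecMulVec, Matrix.vecMulVec_mul, Matrix.vecMulVec_apply]
  rfl

/-- This is unitarity in the Schmidt basis. With `s` the `i`-th column of `S`, the sum over `y` of
the form at `|s⟩⟨y|, |y⟩⟨s|` is computed twice: by the diagonal expansion `fst_eq`, and by expanding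
`s` in the standard basis, where the unitarity constraint applies. -/
theorem IsSchmidt.lin_eq (h : IsSchmidt S Γ M m N) (hw : ∀ j, constraint M j w = 0)
    (i : κ × κ) (C : Matrix (κ × κ) (κ × κ) ℂ) :
    w.1 (basisUnit S i i) (basisUnit S i i) C = w.2 C := by
  have hu : ∀ i j, ∑ x, star (S x i) * S x j = if i = j then 1 else 0 := by
    intro i j
    have := congrFun (congrFun h.unitary i) j
    simpa [Matrix.mul_apply, Matrix.one_apply] using this
  have h1 : ∀ x z, ∑ y, w.1 (Matrix.single x y 1) (Matrix.single y z 1) C =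
      if x = z then w.2 C else 0 := by
    intro x z
    have := hw (Sum.inr <| Sum.inr <| Sum.inr <| Sum.inl (x, z, C))
    simp only [constraint, Sum.elim_inl, Sum.elim_inr, evalTri_apply, evalLin_apply,
      LinearMap.sub_apply, LinearMap.sum_apply, LinearMap.smul_apply, sub_eq_zero] at this
    rw [this]
    split_ifs <;> simp
  have h2 : ∀ y, w.1 (Matrix.vecMulVec (fun x => S x i) (Pi.single y 1))
      (Matrix.vecMulVec (Pi.single y 1) (fun x => star (S x i))) C =
      star (S y i) * S y i * w.1 (basisUnit S i i) (basisUnit S i i) C := by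
    intro y
    rw [h.fst_eq hw, Finset.sum_eq_single i, Finset.sum_eq_single i]
    · simp only [conj_vecMulVec, hu]
      simp [Pi.single_apply, mul_comm]
    · intro j _ hj
      simp only [conj_vecMulVec, hu, if_neg hj.symm, mul_zero, zero_mul]
    · simp
    · intro j _ hj
      refine Finset.sum_eq_zero fun k _ => ?_
      simp only [conj_vecMulVec, hu, if_neg hj, zero_mul]
    · simp
  have h3 : ∀ y, w.1 (Matrix.vecMulVec (fun x => S x i) (Pi.single y 1))
      (Matrix.vecMulVec (Pi.single y 1) (fun x => star (S x i))) C =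
      ∑ x, ∑ z, S x i * (star (S z i) *
        w.1 (Matrix.single x y 1) (Matrix.single y z 1) C) := by
    intro y
    have e1 : Matrix.vecMulVec (fun x => S x i) (Pi.single y 1) =
        ∑ x, S x i • Matrix.single x y (1 : ℂ) := by
      ext p q
      simp [Matrix.vecMulVec_apply, Matrix.sum_apply, Matrix.single_apply, Pi.single_apply,
        ite_and, eq_comm]
    have e2 : Matrix.vecMulVec (Pi.single y 1) (fun x => star (S x i)) =
        ∑ x, star (S x i) • Matrix.single y x (1 : ℂ) := by
      ext p q
      simp [Matrix.vecMulVec_apply, Matrix.sum_apply, Matrix.single_apply, Pi.single_apply,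
        ite_and, eq_comm]
    rw [e1, e2]
    simp only [map_sum, map_smul, LinearMap.sum_apply, LinearMap.smul_apply, smul_eq_mul,
      Finset.mul_sum]
    rw [Finset.sum_comm]
    refine Finset.sum_congr rfl fun x _ => Finset.sum_congr rfl fun z _ => by ring
  have h4 : ∑ y, w.1 (Matrix.vecMulVec (fun x => S x i) (Pi.single y 1))
      (Matrix.vecMulVec (Pi.single y 1) (fun x => star (S x i))) C =
      w.1 (basisUnit S i i) (basisUnit S i i) C := by
    simp only [h2, ← Finset.sum_mul]
    rw [hu, if_pos rfl, one_mul]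
  rw [← h4]
  simp only [h3]
  rw [Finset.sum_comm]
  have h5 : ∀ x, ∑ y, ∑ z, S x i * (star (S z i) *
      w.1 (Matrix.single x y 1) (Matrix.single y z 1) C) = star (S x i) * S x i * w.2 C := by
    intro x
    rw [Finset.sum_comm]
    simp only [← Finset.mul_sum, h1]
    simp
    ring
  simp only [h5, ← Finset.sum_mul]
  rw [hu, if_pos rfl, one_mul]

/-- The second-and-fourth-party constraint after substituting `M = S diag(m) Γ`: it factors into
partial traces of the left and of the right Schmidt vectors. -/
theorem IsSchmidt.sum_marginal (h : IsSchmidt S Γ M m N) (hw : ∀ j, constraint M j w = 0)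
    (b b' e e' : κ) (k : κ × κ) :
    ∑ i, ∑ j, m i * star (m j) * (schmidtTri S w i j k - schmidtLin S w k) *
      (∑ a, S (a, b) i * star (S (a, b') j)) * (∑ c, Γ i (c, e) * star (Γ j (c, e'))) = 0 := by
  have hu : ∀ i j, ∑ x, star (S x i) * S x j = if i = j then 1 else 0 := by
    intro i j
    have := congrFun (congrFun h.unitary i) j
    simpa [Matrix.mul_apply, Matrix.one_apply] using this
  have hMapp : ∀ x z, M x z = ∑ i, S x i * m i * Γ i z := by
    intro x z
    rw [h.eq_mul, Matrix.mul_apply]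
    simp [Matrix.mul_diagonal]
  have hc : ∀ i z, ∑ x, star (S x i) * M x z = m i * Γ i z := by
    intro i z
    have : S.conjTranspose * M = Matrix.diagonal m * Γ := by
      rw [h.eq_mul, mul_assoc, ← mul_assoc, h.unitary, one_mul]
    have := congrFun (congrFun this i) z
    rw [Matrix.diagonal_mul] at this
    simpa [Matrix.mul_apply] using this
  have hc' : ∀ i z, ∑ x, star (M x z) * S x i = star (m i) * star (Γ i z) := by
    intro i z
    have := congrArg star (hc i z)
    rw [star_sum, star_mul'] at this
    rw [← this]
    exact Finset.sum_congr rfl fun x _ => by rw [star_mul', star_star, mul_comm]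
  have hcon := hw (Sum.inr <| Sum.inr <| Sum.inr <| Sum.inr ((b, b'), (e, e'), basisUnit S k k))
  simp only [constraint, Sum.elim_inr, evalTri_apply, evalLin_apply,
    LinearMap.sub_apply, LinearMap.sum_apply, LinearMap.smul_apply, smul_eq_mul] at hcon
  have h1 : ∀ a c, w.1 (Matrix.vecMulVec (fun x => M x (c, e)) (Pi.single (a, b) 1))
      (Matrix.vecMulVec (Pi.single (a, b') 1) (fun x => star (M x (c, e')))) (basisUnit S k k) =
      ∑ i, ∑ j, m i * star (m j) * schmidtTri S w i j k * (S (a, b) i * star (S (a, b') j)) *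
        (Γ i (c, e) * star (Γ j (c, e'))) := by
    intro a c
    rw [h.fst_eq hw]
    refine Finset.sum_congr rfl fun i _ => Finset.sum_congr rfl fun j _ => ?_
    rw [conj_vecMulVec, conj_vecMulVec, hc, hc']
    simp only [Pi.single_apply, mul_ite, ite_mul, mul_one, one_mul, mul_zero, zero_mul,
      Finset.sum_ite_eq', Finset.mem_univ, if_true, schmidtTri]
    ring
  have h2 : ∀ a c, M (a, b) (c, e) * star (M (a, b') (c, e')) = ∑ i, ∑ j,
      m i * star (m j) * (S (a, b) i * star (S (a, b') j)) * (Γ i (c, e) * star (Γ j (c, e'))) := by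
    intro a c
    rw [hMapp, hMapp, star_sum, Finset.sum_mul_sum]
    refine Finset.sum_congr rfl fun i _ => Finset.sum_congr rfl fun j _ => ?_
    simp only [star_mul']
    ring
  have h3 : ∀ i j, m i * star (m j) * (schmidtTri S w i j k - schmidtLin S w k) *
      (∑ a, S (a, b) i * star (S (a, b') j)) * (∑ c, Γ i (c, e) * star (Γ j (c, e'))) =
      ∑ a, ∑ c, (m i * star (m j) * schmidtTri S w i j k * (S (a, b) i * star (S (a, b') j)) *
        (Γ i (c, e) * star (Γ j (c, e'))) - m i * star (m j) * (S (a, b) i * star (S (a, b') j)) *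
        (Γ i (c, e) * star (Γ j (c, e'))) * schmidtLin S w k) := by
    intro i j
    rw [mul_assoc, Finset.sum_mul_sum, Finset.mul_sum]
    refine Finset.sum_congr rfl fun a _ => ?_
    rw [Finset.mul_sum]
    exact Finset.sum_congr rfl fun c _ => by ring
  have hswap : ∀ f : κ × κ → κ × κ → κ → κ → ℂ,
      ∑ i, ∑ j, ∑ a, ∑ c, f i j a c = ∑ a, ∑ c, ∑ i, ∑ j, f i j a c := by
    intro f
    have h3 : ∀ g : κ × κ → κ → κ → ℂ, ∑ i, ∑ a, ∑ c, g i a c = ∑ a, ∑ c, ∑ i, g i a c := by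
      intro g
      rw [Finset.sum_comm]
      exact Finset.sum_congr rfl fun a _ => Finset.sum_comm
    simp only [h3]
  simp only [h3]
  rw [hswap, ← hcon]
  simp only [h1, h2, Finset.sum_mul, ← Finset.sum_sub_distrib]
  rfl

theorem IsSchmidt.eq_zero (h : IsSchmidt S Γ M m N) (hw : ∀ j, constraint M j w = 0)
    (hτ : ∀ i j k, schmidtTri S w i j k = 0) : w = 0 := by
  have h3 : ∀ A B C, w.1 A B C = 0 := by
    intro A B C
    rw [h.fst_eq hw]
    refine Finset.sum_eq_zero fun i _ => Finset.sum_eq_zero fun j _ => ?_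
    -- No commutation constraint acts on the third slot; outer symmetry moves `C` into the first
    -- one, where the diagonal expansion is available.
    rw [IsSchmidt.tri_comm hw, h.fst_eq hw, Finset.sum_eq_zero, mul_zero]
    intro k _
    refine Finset.sum_eq_zero fun l _ => ?_
    have : w.1 (basisUnit S k k) (basisUnit S l l) (basisUnit S i i) = 0 := hτ k l i
    rw [this, mul_zero]
  have h4 : ∀ C, w.2 C = 0 := by
    intro C
    by_cases hκ : Nonempty (κ × κ)
    · obtain ⟨i⟩ := hκ
      rw [← h.lin_eq hw i, h3]
    · have : IsEmpty (κ × κ) := not_nonempty_iff.1 hκ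
      rw [Subsingleton.elim C 0, map_zero]
  refine Prod.ext ?_ ?_
  · exact LinearMap.ext fun A => LinearMap.ext fun B => LinearMap.ext fun C => h3 A B C
  · exact LinearMap.ext fun C => h4 C

theorem IsSchmidt.lin_one (h : IsSchmidt S Γ M m N) : w.2 1 = ∑ k, schmidtLin S w k := by
  have : (1 : Matrix (κ × κ) (κ × κ) ℂ) = ∑ k, basisUnit S k k := by
    simp only [basisUnit, ← Matrix.sum_mul, ← Matrix.mul_sum]
    have h1 : ∑ k, Matrix.single k k (1 : ℂ) = (1 : Matrix (κ × κ) (κ × κ) ℂ) := by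
      simpa using (Matrix.sum_single_eq_diagonal (fun _ : κ × κ => (1 : ℂ)))
    rw [h1, mul_one, h.unitary']
  rw [this, map_sum]
  rfl

end

end FormPair

/-! ### The example: generic phases, distinct weights and parallelogram relations. -/

/-- Finitely many trigonometric polynomials of degree one have a common nonzero on the circle. -/
theorem exists_unit_forall_ne_zero {K : Type*} [Fintype K] (α β γ : K → ℂ) (hα : ∀ k, α k ≠ 0) :
    ∃ η : ℂ, η * star η = 1 ∧ ∀ k, α k * η + β k + γ k * star η ≠ 0 := by
  -- On the unit circle, multiplication by `η` turns each expression into the value at `η` of a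
  -- nonzero quadratic polynomial, and the circle is infinite.
  let q : K → Polynomial ℂ := fun k =>
    Polynomial.C (α k) * Polynomial.X ^ 2 + Polynomial.C (β k) * Polynomial.X + Polynomial.C (γ k)
  have hq : ∀ k, q k ≠ 0 := fun k h => hα k <| by
    have := congrArg (fun p => Polynomial.coeff p 2) h
    simpa [q, Polynomial.coeff_X, Polynomial.coeff_C] using this
  have hinf : (Metric.sphere (0 : ℂ) 1).Infinite := by
    refine (isPreconnected_sphere (by simp) 0 1).infinite_of_nontrivial ⟨1, by simp, -1, by simp, ?_⟩
    norm_num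
  obtain ⟨η, hη, hroot⟩ := hinf.exists_notMem_finset (∏ k, q k).roots.toFinset
  have hη1 : η * star η = 1 := by
    rw [Complex.star_def, Complex.mul_conj, Complex.normSq_eq_norm_sq, mem_sphere_zero_iff_norm.1 hη]
    simp
  refine ⟨η, hη1, fun k h => hroot ?_⟩
  rw [Multiset.mem_toFinset, Polynomial.mem_roots (Finset.prod_ne_zero_iff.2 fun k _ => hq k),
    Polynomial.IsRoot, Polynomial.eval_prod]
  refine Finset.prod_eq_zero (Finset.mem_univ k) ?_
  simp only [q, Polynomial.eval_add, Polynomial.eval_mul, Polynomial.eval_C, Polynomial.eval_pow,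
    Polynomial.eval_X]
  linear_combination η * h - γ k * hη1

section RigidExample

variable {d : ℕ} [NeZero d]

/-- The standard additive character of `ZMod d`. -/
local notation "𝐞" => (ZMod.stdAddChar : AddChar (ZMod _) ℂ)

/-- Pairwise distinct positive Schmidt coefficients. -/
def schmidtWeight (i : ZMod d × ZMod d) : ℝ := d * i.1.val + i.2.val + 1

omit [NeZero d] in
theorem schmidtWeight_pos (i : ZMod d × ZMod d) : 0 < schmidtWeight i := by
  unfold schmidtWeight; positivity

theorem schmidtWeight_lt {i j : ZMod d × ZMod d} (h : i.1.val < j.1.val) :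
    schmidtWeight i < schmidtWeight j := by
  have h1 := ZMod.val_lt i.2
  have h2 : d * i.1.val + i.2.val + 1 < d * j.1.val + j.2.val + 1 := by nlinarith
  unfold schmidtWeight
  exact_mod_cast h2

theorem schmidtWeight_injective : Function.Injective (schmidtWeight (d := d)) := by
  intro i j h
  have h1 : i.1.val = j.1.val := by
    rcases lt_trichotomy i.1.val j.1.val with h1 | h1 | h1
    · exact absurd h (schmidtWeight_lt h1).ne
    · exact h1
    · exact absurd h (schmidtWeight_lt h1).ne'
  have h2 : i.2.val = j.2.val := by
    unfold schmidtWeight at h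
    rw [h1] at h
    have : (i.2.val : ℝ) = j.2.val := by linarith
    exact_mod_cast this
  exact Prod.ext (ZMod.val_injective d h1) (ZMod.val_injective d h2)

/-- The weights increase lexicographically, so the first coordinates alone decide which product is
larger. -/
theorem schmidtWeight_mul_ne {p i k j : ZMod d × ZMod d} (hi : i.1 = p.1) (hj : j.1 = k.1)
    (hk : k.1 ≠ p.1) :
    schmidtWeight p * schmidtWeight i ≠ schmidtWeight k * schmidtWeight j := by
  have hpos := schmidtWeight_pos (d := d)
  rcases lt_or_gt_of_ne fun h => hk (ZMod.val_injective d h) with h | h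
  · exact (mul_lt_mul'' (schmidtWeight_lt h) (schmidtWeight_lt (by rw [hj, hi]; exact h))
      (hpos k).le (hpos j).le).ne'
  · exact (mul_lt_mul'' (schmidtWeight_lt h) (schmidtWeight_lt (by rw [hj, hi]; exact h))
      (hpos p).le (hpos i).le).ne

/-- A symmetric tensor with unit contraction whose deviation from its contraction is, along every
translation, constant up to the phases of the Weyl operators satisfies one relation for each
parallelogram. -/
theorem parallelogram_relation {τ : ZMod d × ZMod d → ZMod d × ZMod d → ZMod d × ZMod d → ℂ}
    {t : ZMod d × ZMod d → ℂ} (hsymm : ∀ i j k, τ i j k = τ k j i)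
    (hdiag : ∀ i k, τ i i k = t k)
    {c : ZMod d × ZMod d → ZMod d × ZMod d → ℂ}
    (hc : ∀ v k i, v ≠ 0 → schmidtWeight i * schmidtWeight (i + v) * (τ i (i + v) k - t k) *
      𝐞 (i.2 * v.1) = c v k) {p k i j u v : ZMod d × ZMod d} (hk : k = p + u) (hi : i = p + v)
    (hj : j = p + u + v) (hu : u ≠ 0) (hv : v ≠ 0) :
    (t p - t k) * (1 - 𝐞 (-(v.2 * u.1)) *
      ((schmidtWeight p * schmidtWeight k : ℝ) / (schmidtWeight i * schmidtWeight j : ℝ) : ℝ)) =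
    (t p - t i) * (1 - 𝐞 (-(u.2 * v.1)) *
      ((schmidtWeight p * schmidtWeight i : ℝ) / (schmidtWeight k * schmidtWeight j : ℝ) : ℝ)) := by
  have hne : ∀ x : ZMod d × ZMod d, (schmidtWeight x : ℂ) ≠ 0 := fun x =>
    Complex.ofReal_ne_zero.2 (schmidtWeight_pos x).ne'
  have hadd : ∀ x y : ZMod d, 𝐞 (x + y) = 𝐞 x * 𝐞 y := fun x y => AddChar.map_add_eq_mul _ x y
  have hinv : ∀ x : ZMod d, 𝐞 (-x) * 𝐞 x = 1 := fun x => by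
    rw [← hadd, neg_add_cancel, AddChar.map_zero_eq_one]
  have hpk := hc u k p hu
  have hpi := hc v i p hv
  have hij := hc u k i hu
  have hkj := hc v i k hv
  rw [← hk] at hpk
  rw [← hi] at hpi
  rw [show i + u = j by rw [hi, hj]; abel] at hij
  rw [show k + v = j by rw [hk, hj]] at hkj
  -- At the base point the tensor is known: `τ p k k = τ k k p = t p`, and likewise with `i`.
  -- Transporting along `u` from `p, k` to `i, j`, and along `v` from `p, i` to `k, j`, gives the
  -- two values of `τ i j k` in `hij'` and `hkj'`.
  rw [hsymm, hdiag] at hpk hpi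
  rw [hsymm k j i] at hkj
  have e1 : 𝐞 (i.2 * u.1) = 𝐞 (p.2 * u.1) * 𝐞 (v.2 * u.1) := by
    rw [← hadd, hi, Prod.snd_add, add_mul]
  have e2 : 𝐞 (k.2 * v.1) = 𝐞 (p.2 * v.1) * 𝐞 (u.2 * v.1) := by
    rw [← hadd, hk, Prod.snd_add, add_mul]
  rw [← hpk, e1] at hij
  rw [← hpi, e2] at hkj
  have h1 := hinv (v.2 * u.1)
  have h2 := hinv (u.2 * v.1)
  have h3 := hinv (p.2 * u.1)
  have h4 := hinv (p.2 * v.1)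
  have n1 := right_ne_zero_of_mul_eq_one h1
  have n2 := right_ne_zero_of_mul_eq_one h2
  have n3 := right_ne_zero_of_mul_eq_one h3
  have n4 := right_ne_zero_of_mul_eq_one h4
  have hij' : τ i j k - t k = (t p - t k) * (𝐞 (-(v.2 * u.1)) *
      ((schmidtWeight p * schmidtWeight k : ℝ) / (schmidtWeight i * schmidtWeight j : ℝ) : ℝ)) := by
    rw [eq_inv_of_mul_eq_one_left h1]
    have := hne i; have := hne j
    push_cast
    field_simp
    apply mul_left_cancel₀ n3
    linear_combination hij
  have hkj' : τ i j k - t i = (t p - t i) * (𝐞 (-(u.2 * v.1)) *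
      ((schmidtWeight p * schmidtWeight i : ℝ) / (schmidtWeight k * schmidtWeight j : ℝ) : ℝ)) := by
    rw [eq_inv_of_mul_eq_one_left h2]
    have := hne k; have := hne j
    push_cast
    field_simp
    apply mul_left_cancel₀ n4
    linear_combination hkj
  linear_combination hij' - hkj'

/-- The unit square at `p` relates `t p - t k` to `t p - t i`, and as `b ≠ 1` it suffices that the
first difference vanishes. The missing equations come from other parallelograms on the same four
points. -/
theorem eq_of_parallelogram_relation [Fact (1 < d)] {t : ZMod d × ZMod d → ℂ}
    (hQ : ∀ {p k i j u v : ZMod d × ZMod d}, k = p + u → i = p + v → j = p + u + v → u ≠ 0 →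
      v ≠ 0 → (t p - t k) * (1 - 𝐞 (-(v.2 * u.1)) *
      ((schmidtWeight p * schmidtWeight k : ℝ) / (schmidtWeight i * schmidtWeight j : ℝ) : ℝ)) =
    (t p - t i) * (1 - 𝐞 (-(u.2 * v.1)) *
      ((schmidtWeight p * schmidtWeight i : ℝ) / (schmidtWeight k * schmidtWeight j : ℝ) : ℝ)))
    (p : ZMod d × ZMod d) : t p = t (p + (1, 0)) ∧ t p = t (p + (0, 1)) := by
  set u : ZMod d × ZMod d := (1, 0) with hu
  set v : ZMod d × ZMod d := (0, 1) with hv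
  have hu0 : u ≠ 0 := by simp [hu]
  have hv0 : v ≠ 0 := by simp [hv]
  obtain ⟨k, hk⟩ : ∃ k, k = p + u := ⟨_, rfl⟩
  obtain ⟨i, hi⟩ : ∃ i, i = p + v := ⟨_, rfl⟩
  obtain ⟨j, hj⟩ : ∃ j, j = p + u + v := ⟨_, rfl⟩
  rw [← hk, ← hi]
  set a : ℝ := (schmidtWeight p * schmidtWeight k) / (schmidtWeight i * schmidtWeight j) with ha
  set b : ℝ := (schmidtWeight p * schmidtWeight i) / (schmidtWeight k * schmidtWeight j) with hb
  have hp0 := schmidtWeight_pos p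
  have hk0 := schmidtWeight_pos k
  have hi0 := schmidtWeight_pos i
  have hj0 := schmidtWeight_pos j
  have ha0 : 0 < a := by positivity
  have hb0 : 0 < b := by positivity
  have haC : (a : ℂ) ≠ 0 := Complex.ofReal_ne_zero.2 ha0.ne'
  have hbC : (b : ℂ) ≠ 0 := Complex.ofReal_ne_zero.2 hb0.ne'
  have hb1 : (1 : ℂ) - b ≠ 0 := by
    rw [sub_ne_zero, ne_comm]
    intro h
    have h' : b = 1 := by exact_mod_cast h
    rw [hb, div_eq_one_iff_eq (by positivity)] at h'
    exact schmidtWeight_mul_ne (by simp [hi, hv]) (by simp [hj, hk, hv]) (by simp [hk, hu]) h'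
  have hεε : 𝐞 (-1 : ZMod d) * 𝐞 (1 : ZMod d) = 1 := by
    rw [← AddChar.map_add_eq_mul, neg_add_cancel, AddChar.map_zero_eq_one]
  have h1 := hQ hk hi hj hu0 hv0
  simp only [hu, hv, mul_one, zero_mul, neg_zero, AddChar.map_zero_eq_one, one_mul] at h1
  rw [← ha, ← hb] at h1
  suffices h : t p - t k = 0 by
    rw [h, zero_mul, eq_comm, mul_eq_zero] at h1
    exact ⟨sub_eq_zero.1 h, sub_eq_zero.1 (h1.resolve_right hb1)⟩
  -- When `2 = 0`, the diagonal `u + v` can serve as a side, since `j + u = i` and `j + v = k`. The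
  -- three relations at `p` then combine to `(t p - t j) * c = 0`, and `h3` reduces to `(t p - t k)
  -- * (1 + a) = 0` with `a > 0`.
  by_cases h2 : (2 : ZMod d) = 0
  · have h11 : (-1 : ZMod d) = 1 := by linear_combination -h2
    have hε : 𝐞 (1 : ZMod d) = -1 := by
      rw [h11] at hεε
      refine (mul_self_eq_one_iff.1 hεε).resolve_left fun h => ?_
      rw [← AddChar.map_zero_eq_one (ZMod.stdAddChar : AddChar (ZMod d) ℂ)] at h
      exact one_ne_zero (ZMod.injective_stdAddChar h)
    have hw0 : u + v ≠ 0 := by simp [hu, hv]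
    have hjw : j = p + (u + v) := by rw [hj, add_assoc]
    have h22 : ∀ x : ZMod d × ZMod d, x + x = 0 := fun x => by
      ext <;> simp [← two_mul, h2]
    have h3 := hQ hk hjw (show i = p + u + (u + v) by
      rw [hi, add_assoc, ← add_assoc u, h22, zero_add]) hu0 hw0
    have h4 := hQ hi hjw (show k = p + v + (u + v) by
      rw [hk, add_assoc, add_comm u v, ← add_assoc v, h22, zero_add]) hv0 hw0
    set c : ℝ := (schmidtWeight p * schmidtWeight j) / (schmidtWeight k * schmidtWeight i) with hc
    have hc0 : (c : ℂ) ≠ 0 := Complex.ofReal_ne_zero.2 (by positivity)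
    rw [mul_comm (schmidtWeight j), ← ha] at h3
    rw [mul_comm (schmidtWeight j), ← hb, mul_comm (schmidtWeight i) (schmidtWeight k), ← hc] at h4
    simp only [hu, hv, Prod.mk_add_mk, add_zero, zero_add, mul_one, mul_zero, neg_zero,
      AddChar.map_zero_eq_one, one_mul, h11, hε] at h1 h3 h4
    have hj0 : t p - t j = 0 := by
      apply (mul_eq_zero.1 _).resolve_right hc0
      linear_combination (h3 - h1 - h4) / 2
    rw [hj0, zero_mul] at h3
    refine (mul_eq_zero.1 h3).resolve_right ?_
    have : (1 + a : ℝ) ≠ 0 := by positivity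
    intro h
    apply this
    have h' : ((1 + a : ℝ) : ℂ) = 0 := by push_cast; linear_combination h
    exact_mod_cast h'
  · have hconj : (starRingEnd ℂ) (𝐞 (-1 : ZMod d)) = 𝐞 (1 : ZMod d) := by
      rw [← AddChar.map_neg_eq_conj, neg_neg]
    have hne : 𝐞 (1 : ZMod d) - 𝐞 (-1 : ZMod d) ≠ 0 := by
      rw [sub_ne_zero]
      intro h
      exact h2 (by linear_combination ZMod.injective_stdAddChar h)
    have hεa : 1 - 𝐞 (-1 : ZMod d) * a ≠ 0 := by
      intro h
      apply hne
      have h' := congrArg (starRingEnd ℂ) h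
      rw [map_sub, map_mul, hconj, map_one, map_zero, Complex.conj_ofReal] at h'
      apply (mul_eq_zero.1 _).resolve_right haC
      linear_combination h - h'
    -- The same square based at the corners `k` and `i`. With `h1` this gives three equations for
    -- the three differences from `t p`; eliminating `t i` and `t j` in `hfin` leaves a factor that
    -- is nonzero because `𝐞 1 ≠ 𝐞 (-1)`.
    have h3 := hQ (show p = k + -u by rw [hk]; abel) (show j = k + v by rw [hj, hk])
      (show i = k + -u + v by rw [hi, hk]; abel) (neg_ne_zero.2 hu0) hv0
    have h4 := hQ (show j = i + u by rw [hj, hi]; abel) (show p = i + -v by rw [hi]; abel)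
      (show k = i + u + -v by rw [hi, hk]; abel) hu0 (neg_ne_zero.2 hv0)
    rw [mul_comm (schmidtWeight j), mul_comm (schmidtWeight k) (schmidtWeight p), ← ha,
      ← inv_div, ← hb] at h3
    rw [mul_comm (schmidtWeight j), mul_comm (schmidtWeight i) (schmidtWeight p), ← hb,
      ← inv_div, ← ha] at h4
    simp only [hu, hv, Prod.fst_neg, Prod.snd_neg, mul_one, mul_zero, neg_zero, mul_neg,
      neg_neg, AddChar.map_zero_eq_one, one_mul, Complex.ofReal_inv] at h1 h3 h4
    set ε := 𝐞 (-1 : ZMod d)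
    set ε' := 𝐞 (1 : ZMod d)
    have H3 : (t p - t j) * (1 - b) = (t p - t k) * (1 - ε' * a * b) := by
      have : (t k - t p) * (1 - ε' * a) * b = (t k - t j) * (b - 1) := by
        rw [h3]
        field_simp
      linear_combination this
    have H4 : (t p - t j) * (1 - ε * a) = (t p - t i) * (1 - ε * a * b) := by
      have : (t i - t j) * (ε * a - ε * ε') = (t i - t p) * (1 - b) * (ε * a) := by
        rw [← h4]
        field_simp
      rw [hεε] at this
      linear_combination -this
    have hfin : (t p - t k) * ((1 - ε * a) * (a * b * (ε' - ε))) = 0 := by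
      linear_combination (1 - ε * a) * H3 - (1 - b) * H4 + (1 - ε * a * b) * h1
    exact (mul_eq_zero.1 hfin).resolve_right
      (mul_ne_zero hεa (mul_ne_zero (mul_ne_zero haC hbC) hne))

theorem eq_zero_of_parallelogram_relation [Fact (1 < d)]
    {τ : ZMod d × ZMod d → ZMod d × ZMod d → ZMod d × ZMod d → ℂ}
    {t : ZMod d × ZMod d → ℂ} (hsymm : ∀ i j k, τ i j k = τ k j i)
    (hdiag : ∀ i k, τ i i k = t k)
    {c : ZMod d × ZMod d → ZMod d × ZMod d → ℂ}
    (hc : ∀ v k i, v ≠ 0 → schmidtWeight i * schmidtWeight (i + v) * (τ i (i + v) k - t k) *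
      𝐞 (i.2 * v.1) = c v k) (ht : ∑ k, t k = 0) (i j k : ZMod d × ZMod d) : τ i j k = 0 := by
  have hstep := eq_of_parallelogram_relation (t := t) fun hk hi hj hu hv =>
    parallelogram_relation hsymm hdiag hc hk hi hj hu hv
  have h1 : ∀ n : ℕ, ∀ p, t (p + ((n : ZMod d), 0)) = t p := by
    intro n
    induction n with
    | zero => intro p; rw [Nat.cast_zero]; exact congrArg t (add_zero p)
    | succ n ih =>
      intro p
      rw [← ih p, (hstep (p + ((n : ZMod d), 0))).1, add_assoc]
      simp
  have h2 : ∀ n : ℕ, ∀ p, t (p + (0, (n : ZMod d))) = t p := by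
    intro n
    induction n with
    | zero => intro p; rw [Nat.cast_zero]; exact congrArg t (add_zero p)
    | succ n ih =>
      intro p
      rw [← ih p, (hstep (p + (0, (n : ZMod d)))).2, add_assoc]
      simp
  have hconst : ∀ p, t p = t 0 := by
    intro p
    have e : p = 0 + ((p.1.val : ZMod d), 0) + (0, (p.2.val : ZMod d)) := by simp
    rw [e, h2, h1]
  have ht0 : ∀ p, t p = 0 := by
    intro p
    rw [hconst]
    simp only [hconst, Finset.sum_const, Finset.card_univ, nsmul_eq_mul, mul_eq_zero,
      Nat.cast_eq_zero, Fintype.card_ne_zero, false_or] at ht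
    exact ht
  rcases eq_or_ne i j with rfl | hij
  · rw [hdiag, ht0]
  have hv : j - i ≠ 0 := sub_ne_zero.2 hij.symm
  -- The constant is read off at the translate ending in `k`, where symmetry and `hdiag` give an
  -- entry of `t`, now known to vanish.
  have hzero : c (j - i) k = 0 := by
    rw [← hc (j - i) k (k - (j - i)) hv, sub_add_cancel, hsymm, hdiag, ht0, ht0]
    ring
  have h := hc (j - i) k i hv
  rw [hzero, add_sub_cancel, ht0, sub_zero] at h
  have hne : ∀ x : ZMod d × ZMod d, (schmidtWeight x : ℂ) ≠ 0 := fun x =>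
    Complex.ofReal_ne_zero.2 (schmidtWeight_pos x).ne'
  have he : 𝐞 (i.2 * (j - i).1) ≠ 0 := fun h0 => by
    have := AddChar.map_add_eq_mul 𝐞 (i.2 * (j - i).1) (-(i.2 * (j - i).1))
    rw [add_neg_cancel, AddChar.map_zero_eq_one, h0, zero_mul] at this
    exact one_ne_zero this
  simpa [hne] using (mul_eq_zero.1 h).resolve_right he

/-! ### Fourier analysis, Bell states and rigidity of the example. -/

/-- The pairing of `ZMod d × ZMod d` with itself. -/
noncomputable def charPair (x y : ZMod d × ZMod d) : ℂ := 𝐞 (x.1 * y.1 + x.2 * y.2)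

theorem charPair_add_left (x x' y : ZMod d × ZMod d) :
    charPair (x + x') y = charPair x y * charPair x' y := by
  unfold charPair
  rw [← AddChar.map_add_eq_mul]
  congr 1
  simp only [Prod.fst_add, Prod.snd_add]
  ring

theorem charPair_comm (x y : ZMod d × ZMod d) : charPair x y = charPair y x := by
  unfold charPair
  rw [mul_comm x.1, mul_comm x.2]

theorem charPair_add_right (x y y' : ZMod d × ZMod d) :
    charPair x (y + y') = charPair x y * charPair x y' := by
  rw [charPair_comm, charPair_add_left, charPair_comm y, charPair_comm y']

theorem charPair_neg_left (x y : ZMod d × ZMod d) : charPair (-x) y = star (charPair x y) := by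
  unfold charPair
  rw [Complex.star_def, ← AddChar.map_neg_eq_conj]
  congr 1
  simp only [Prod.fst_neg, Prod.snd_neg]
  ring

theorem charPair_mul_star (x y : ZMod d × ZMod d) : charPair x y * star (charPair x y) = 1 := by
  rw [← charPair_neg_left, ← charPair_add_left, add_neg_cancel]
  simp [charPair]

theorem sum_charPair (y : ZMod d × ZMod d) :
    ∑ x, charPair x y = if y = 0 then (d : ℂ) ^ 2 else 0 := by
  have h : ∀ a : ZMod d, ∑ x : ZMod d, 𝐞 (x * a) = if a = 0 then (d : ℂ) else 0 := by
    intro a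
    rw [AddChar.sum_mulShift a (ZMod.isPrimitive_stdAddChar d)]
    simp
  simp only [charPair, AddChar.map_add_eq_mul, Fintype.sum_prod_type, ← Finset.mul_sum, ← Finset.sum_mul, h]
  by_cases h1 : y.1 = 0 <;> by_cases h2 : y.2 = 0 <;> simp [h1, h2, Prod.ext_iff, sq]

/-- A function whose nonconstant Fourier coefficients vanish is constant. -/
theorem eq_of_fourier_eq_zero (g : ZMod d × ZMod d → ℂ)
    (hg : ∀ x, x ≠ 0 → ∑ i, g i * star (charPair x i) = 0) (i : ZMod d × ZMod d) : g i = g 0 := by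
  have hd : (d : ℂ) ^ 2 ≠ 0 := pow_ne_zero _ (Nat.cast_ne_zero.2 (NeZero.ne d))
  have key : ∀ i, (d : ℂ) ^ 2 * g i = ∑ j, g j := by
    intro i
    have h1 : ∑ x, charPair x i * ∑ j, g j * star (charPair x j) = ∑ j, g j := by
      rw [Finset.sum_eq_single 0]
      · simp [charPair]
      · intro x _ hx
        rw [hg x hx, mul_zero]
      · simp
    rw [← h1]
    simp only [Finset.mul_sum]
    rw [Finset.sum_comm]
    have h2 : ∀ j, ∑ x, charPair x i * (g j * star (charPair x j)) =
        g j * if i - j = 0 then (d : ℂ) ^ 2 else 0 := by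
      intro j
      rw [← sum_charPair, Finset.mul_sum]
      refine Finset.sum_congr rfl fun x _ => ?_
      rw [sub_eq_add_neg, charPair_add_right, charPair_comm x (-j), charPair_neg_left,
        charPair_comm j]
      ring
    simp only [h2, sub_eq_zero]
    simp [mul_comm]
  exact mul_left_cancel₀ hd ((key i).trans (key 0).symm)

/-- The orthonormal basis of maximally entangled states, as columns. -/
noncomputable def bellMatrix (d : ℕ) [NeZero d] : Matrix (ZMod d × ZMod d) (ZMod d × ZMod d) ℂ :=
  Matrix.of fun x i => if x.1 = x.2 + i.1 then ((√d : ℝ) : ℂ)⁻¹ * 𝐞 (i.2 * x.2) else 0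

/-- The phases of the superpositions of maximally entangled states in the example. -/
def phase (η : ℂ) (x : ZMod d × ZMod d) : ℂ := if x = 0 then η else 1

/-- An orthogonal basis of superpositions of maximally entangled states, as rows. -/
noncomputable def bellSuperposition (η : ℂ) : Matrix (ZMod d × ZMod d) (ZMod d × ZMod d) ℂ :=
  Matrix.of charPair * Matrix.diagonal (phase η) * (bellMatrix d).transpose

/-- The four-party tensor whose linear constraints only have trivial solutions. -/
noncomputable def rigidTensor (η : ℂ) : Matrix (ZMod d × ZMod d) (ZMod d × ZMod d) ℂ :=
  bellMatrix d * Matrix.diagonal (fun i => (schmidtWeight i : ℂ)) * bellSuperposition η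

theorem inv_sqrt_mul_star : ((√d : ℝ) : ℂ)⁻¹ * star ((√d : ℝ) : ℂ)⁻¹ * d = 1 := by
  have h : (0 : ℝ) < d := Nat.cast_pos.2 (NeZero.pos d)
  have h2 : ((√d : ℝ) : ℂ) * ((√d : ℝ) : ℂ) = d := by
    rw [← Complex.ofReal_mul, Real.mul_self_sqrt h.le]; simp
  have h3 : ((√d : ℝ) : ℂ) ≠ 0 := Complex.ofReal_ne_zero.2 (Real.sqrt_pos.2 h).ne'
  rw [Complex.star_def, map_inv₀, Complex.conj_ofReal, ← h2]
  field_simp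

theorem sum_char_mul (a : ZMod d) : ∑ x : ZMod d, 𝐞 (a * x) = if a = 0 then (d : ℂ) else 0 := by
  have := AddChar.sum_mulShift a (ZMod.isPrimitive_stdAddChar d)
  simp only [mul_comm _ a] at this
  rw [this]
  simp

theorem star_char (a : ZMod d) : star (𝐞 a) = 𝐞 (-a) := by
  rw [Complex.star_def, AddChar.map_neg_eq_conj]

/-- The Weyl-operator coefficients of the partial traces of the maximally entangled basis. -/
theorem sum_bell_marginal (v i j : ZMod d × ZMod d) :
    ∑ b, 𝐞 (v.2 * b) * ∑ a, bellMatrix d (a, b) i * star (bellMatrix d (a, b - v.1) j) =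
      if j = i + v then 𝐞 (j.2 * v.1) else 0 := by
  have h1 : ∀ b : ZMod d, ∑ a, bellMatrix d (a, b) i * star (bellMatrix d (a, b - v.1) j) =
      if j.1 = i.1 + v.1 then ((√d : ℝ) : ℂ)⁻¹ * star ((√d : ℝ) : ℂ)⁻¹ *
        (𝐞 (i.2 * b) * 𝐞 (-(j.2 * (b - v.1)))) else 0 := by
    intro b
    rw [Finset.sum_eq_single (b + i.1)]
    · have : (b + i.1 = b - v.1 + j.1) ↔ j.1 = i.1 + v.1 := by
        constructor <;> intro h
        · linear_combination -h
        · linear_combination -h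
      simp only [bellMatrix, Matrix.of_apply, if_true, this]
      split_ifs
      · rw [star_mul', star_char]; ring
      · simp
    · intro a _ ha
      simp [bellMatrix, ha]
    · simp
  simp only [h1]
  by_cases hj : j.1 = i.1 + v.1
  · have h2 : ∀ b : ZMod d, 𝐞 (v.2 * b) * (((√d : ℝ) : ℂ)⁻¹ * star ((√d : ℝ) : ℂ)⁻¹ *
        (𝐞 (i.2 * b) * 𝐞 (-(j.2 * (b - v.1))))) = ((√d : ℝ) : ℂ)⁻¹ * star ((√d : ℝ) : ℂ)⁻¹ *
        𝐞 (j.2 * v.1) * 𝐞 ((i.2 + v.2 - j.2) * b) := by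
      intro b
      have : 𝐞 (v.2 * b) * (𝐞 (i.2 * b) * 𝐞 (-(j.2 * (b - v.1)))) =
          𝐞 (j.2 * v.1) * 𝐞 ((i.2 + v.2 - j.2) * b) := by
        simp only [← AddChar.map_add_eq_mul]
        congr 1
        ring
      linear_combination (((√d : ℝ) : ℂ)⁻¹ * star ((√d : ℝ) : ℂ)⁻¹) * this
    simp only [if_pos hj, h2, ← Finset.mul_sum, sum_char_mul]
    have h3 : j = i + v ↔ i.2 + v.2 - j.2 = 0 := by
      rw [Prod.ext_iff, sub_eq_zero, eq_comm (a := i.2 + v.2)]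
      simp [hj]
    simp only [h3]
    split_ifs
    · linear_combination 𝐞 (j.2 * v.1) * inv_sqrt_mul_star (d := d)
    · simp
  · have h3 : j ≠ i + v := fun h => hj (by rw [h]; rfl)
    simp [hj, h3]

theorem bellMatrix_unitary : (bellMatrix d).conjTranspose * bellMatrix d = 1 := by
  ext j i
  have h := sum_bell_marginal 0 i j
  simp only [Prod.fst_zero, Prod.snd_zero, zero_mul, mul_zero, AddChar.map_zero_eq_one, sub_zero,
    add_zero, one_mul] at h
  rw [Matrix.mul_apply, Fintype.sum_prod_type, Finset.sum_comm, Matrix.one_apply, ← h]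
  simp only [Matrix.conjTranspose_apply, mul_comm]

theorem bellSuperposition_orthogonal {η : ℂ} (hη : η * star η = 1) :
    bellSuperposition (d := d) η * (bellSuperposition η).conjTranspose = (d : ℂ) ^ 2 • 1 := by
  have h1 : (bellMatrix d).transpose * (bellMatrix d).transpose.conjTranspose = 1 := by
    have := congrArg Matrix.transpose (bellMatrix_unitary (d := d))
    rw [Matrix.transpose_mul, Matrix.transpose_one] at this
    exact this
  have h2 : Matrix.diagonal (phase (d := d) η) * (Matrix.diagonal (phase η)).conjTranspose = 1 := by
    rw [Matrix.diagonal_conjTranspose, Matrix.diagonal_mul_diagonal, ← Matrix.diagonal_one]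
    congr 1
    funext x
    by_cases hx : x = 0 <;> simp [phase, hx]
    simpa using hη
  have h3 : bellSuperposition (d := d) η * (bellSuperposition η).conjTranspose =
      Matrix.of charPair * (Matrix.diagonal (phase η) * ((bellMatrix d).transpose *
        (bellMatrix d).transpose.conjTranspose) * (Matrix.diagonal (phase η)).conjTranspose) *
        (Matrix.of (charPair (d := d))).conjTranspose := by
    simp only [bellSuperposition, Matrix.conjTranspose_mul, mul_assoc]
  rw [h3, h1, mul_one, h2, mul_one]
  ext i j
  rw [Matrix.mul_apply, Matrix.smul_apply, Matrix.one_apply]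
  have h4 : ∀ x, Matrix.of charPair i x * (Matrix.of (charPair (d := d))).conjTranspose x j =
      charPair x (i - j) := by
    intro x
    rw [sub_eq_add_neg, charPair_add_right, charPair_comm x (-j), charPair_neg_left,
      charPair_comm x i]
    rfl
  simp only [h4, sum_charPair, sub_eq_zero]
  split_ifs <;> simp

/-- The Weyl-operator coefficients of the partial traces of the superpositions of maximally
entangled states, up to a phase that depends on the superposition. -/
noncomputable def weylOverlap (η : ℂ) (w v : ZMod d × ZMod d) : ℂ :=
  ∑ χ : ZMod d × ZMod d, star (charPair v (χ + w)) * 𝐞 ((χ + w).2 * w.1) *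
    (phase η χ * star (phase η (χ + w)))

/-- For `w ≠ 0` the special phase enters only in the terms `χ = 0` and `χ = -w`, so the overlap is a
trigonometric polynomial of degree one in `η`, with leading coefficient a product of characters. -/
theorem exists_weylOverlap_ne_zero :
    ∃ η : ℂ, η * star η = 1 ∧ ∀ w v : ZMod d × ZMod d, w ≠ 0 → weylOverlap η w v ≠ 0 := by
  let c : ZMod d × ZMod d → ZMod d × ZMod d → ZMod d × ZMod d → ℂ := fun w v χ =>
    star (charPair v (χ + w)) * 𝐞 ((χ + w).2 * w.1)
  obtain ⟨η, hη, h⟩ := exists_unit_forall_ne_zero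
    (K := (ZMod d × ZMod d) × (ZMod d × ZMod d)) (fun k => c k.1 k.2 0)
    (fun k => ∑ χ, c k.1 k.2 χ - c k.1 k.2 0 - c k.1 k.2 (-k.1)) (fun k => c k.1 k.2 (-k.1)) (by
      intro k
      refine mul_ne_zero (right_ne_zero_of_mul_eq_one (charPair_mul_star _ _)) fun h => ?_
      have := AddChar.map_add_eq_mul 𝐞 ((0 + k.1).2 * k.1.1) (-((0 + k.1).2 * k.1.1))
      rw [add_neg_cancel, AddChar.map_zero_eq_one, h, zero_mul] at this
      exact one_ne_zero this)
  refine ⟨η, hη, fun w v hw => ?_⟩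
  convert h (w, v) using 1
  have hphase : ∀ χ, phase η χ * star (phase η (χ + w)) =
      1 + (if χ = 0 then η - 1 else 0) + (if χ = -w then star η - 1 else 0) := by
    intro χ
    rcases eq_or_ne χ 0 with rfl | h0
    · have : (0 : ZMod d × ZMod d) ≠ -w := fun h => hw (by simpa using h.symm)
      simp [phase, hw, this]
    · rcases eq_or_ne χ (-w) with rfl | h1
      · simp [phase, hw]
      · have : χ + w ≠ 0 := fun h => h1 (eq_neg_of_add_eq_zero_left h)
        simp [phase, h0, h1, this]
  simp only [weylOverlap, hphase, mul_add, Finset.sum_add_distrib, mul_ite, mul_zero,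
    Finset.sum_ite_eq', Finset.mem_univ, if_true, mul_one]
  simp only [c]
  ring

/-- In the Bell expansion only the pairs `χ, χ + w` survive. There `charPair i χ` cancels against
its conjugate, so that `i` enters only through one character; this is why the superpositions have
Fourier coefficients. -/
theorem sum_superposition_marginal (η : ℂ) (w v i : ZMod d × ZMod d) :
    ∑ e, 𝐞 (w.2 * e) * ∑ c, bellSuperposition η i (c, e) *
      star (bellSuperposition η (i + v) (c, e - w.1)) =
    star (charPair w i) * weylOverlap η w v := by
  have hΓ : ∀ i z, bellSuperposition η i z =
      ∑ χ, charPair i χ * phase η χ * bellMatrix d z χ := by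
    intro i z
    simp [bellSuperposition, Matrix.mul_apply (N := (bellMatrix d).transpose), Matrix.mul_diagonal]
  have h1 : ∀ e, 𝐞 (w.2 * e) * ∑ c, bellSuperposition η i (c, e) *
      star (bellSuperposition η (i + v) (c, e - w.1)) =
      ∑ χ, ∑ χ', charPair i χ * phase η χ * star (charPair (i + v) χ' * phase η χ') *
        (𝐞 (w.2 * e) * ∑ c, bellMatrix d (c, e) χ * star (bellMatrix d (c, e - w.1) χ')) := by
    intro e
    have h2 : ∀ c, bellSuperposition η i (c, e) *
      star (bellSuperposition η (i + v) (c, e - w.1)) =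
      ∑ χ, ∑ χ', charPair i χ * phase η χ * star (charPair (i + v) χ' * phase η χ') *
        (bellMatrix d (c, e) χ * star (bellMatrix d (c, e - w.1) χ')) := by
      intro c
      rw [hΓ, hΓ, star_sum, Finset.sum_mul_sum]
      refine Finset.sum_congr rfl fun χ _ => Finset.sum_congr rfl fun χ' _ => ?_
      rw [star_mul']
      ring
    simp only [h2]
    rw [Finset.sum_comm, Finset.mul_sum]
    refine Finset.sum_congr rfl fun χ _ => ?_
    rw [Finset.sum_comm, Finset.mul_sum]
    refine Finset.sum_congr rfl fun χ' _ => ?_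
    rw [← Finset.mul_sum]
    ring
  simp only [h1]
  rw [Finset.sum_comm, weylOverlap, Finset.mul_sum]
  refine Finset.sum_congr rfl fun χ _ => ?_
  rw [Finset.sum_comm]
  simp only [← Finset.mul_sum, sum_bell_marginal, mul_ite, mul_zero, Finset.sum_ite_eq',
    Finset.mem_univ, if_true]
  rw [charPair_add_left, charPair_add_right i χ w, charPair_comm i w]
  simp only [star_mul']
  linear_combination (phase η χ * star (charPair w i) * star (charPair v (χ + w)) *
    star (phase η (χ + w)) * 𝐞 ((χ + w).2 * w.1)) * charPair_mul_star i χ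

theorem isSchmidt_rigidTensor {η : ℂ} (hη : η * star η = 1) :
    FormPair.IsSchmidt (bellMatrix d) (bellSuperposition η) (rigidTensor η)
      (fun i => (schmidtWeight i : ℂ)) ((d : ℂ) ^ 2) where
  unitary := bellMatrix_unitary
  orthogonal := bellSuperposition_orthogonal hη
  eq_mul := rfl
  injective := by
    intro i j h
    have hd : (d : ℂ) ^ 2 ≠ 0 := pow_ne_zero _ (Nat.cast_ne_zero.2 (NeZero.ne d))
    have h1 := mul_left_cancel₀ hd h
    simp only [Complex.star_def, Complex.conj_ofReal] at h1
    have h2 : schmidtWeight i * schmidtWeight i = schmidtWeight j * schmidtWeight j := by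
      exact_mod_cast h1
    exact schmidtWeight_injective
      ((mul_self_inj (schmidtWeight_pos i).le (schmidtWeight_pos j).le).1 h2)

theorem isRigid_rigidTensor [Fact (1 < d)] {η : ℂ} (hη : η * star η = 1)
    (h : ∀ w v : ZMod d × ZMod d, w ≠ 0 → weylOverlap η w v ≠ 0) :
    FormPair.IsRigid (rigidTensor (d := d) η) := by
  intro ω hω ht
  have hS := isSchmidt_rigidTensor (d := d) hη
  rw [hS.lin_one] at ht
  set τ := FormPair.schmidtTri (bellMatrix d) ω with hτ
  set t := FormPair.schmidtLin (bellMatrix d) ω with ht'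
  -- Weyl coefficients of the marginal constraint: the index `v` on the second party selects the
  -- pairs `j = i + v`, and `w` on the fourth yields the Fourier coefficient at `w` of the remaining
  -- function of `i`.
  have hmarg : ∀ v w k, ∑ i, (schmidtWeight i * schmidtWeight (i + v) * (τ i (i + v) k - t k) *
      𝐞 ((i + v).2 * v.1)) * (star (charPair w i) * weylOverlap η w v) = 0 := by
    intro v w k
    have h1 : ∑ b, ∑ e, 𝐞 (v.2 * b) * 𝐞 (w.2 * e) *
      (∑ i, ∑ j, (schmidtWeight i : ℂ) * star (schmidtWeight j : ℂ) * (τ i j k - t k) *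
        (∑ a, bellMatrix d (a, b) i * star (bellMatrix d (a, b - v.1) j)) *
        (∑ c, bellSuperposition η i (c, e) * star (bellSuperposition η j (c, e - w.1)))) = 0 := by
      refine Finset.sum_eq_zero fun b _ => Finset.sum_eq_zero fun e _ => ?_
      rw [hS.sum_marginal hω, mul_zero]
    rw [← h1]
    have h2 : ∀ b e, 𝐞 (v.2 * b) * 𝐞 (w.2 * e) *
      (∑ i, ∑ j, (schmidtWeight i : ℂ) * star (schmidtWeight j : ℂ) * (τ i j k - t k) *
        (∑ a, bellMatrix d (a, b) i * star (bellMatrix d (a, b - v.1) j)) *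
        (∑ c, bellSuperposition η i (c, e) * star (bellSuperposition η j (c, e - w.1)))) =
      ∑ i, ∑ j, (schmidtWeight i : ℂ) * star (schmidtWeight j : ℂ) * (τ i j k - t k) *
        ((𝐞 (v.2 * b) * ∑ a, bellMatrix d (a, b) i * star (bellMatrix d (a, b - v.1) j)) *
        (𝐞 (w.2 * e) * ∑ c, bellSuperposition η i (c, e) *
          star (bellSuperposition η j (c, e - w.1)))) := by
      intro b e
      rw [Finset.mul_sum]
      refine Finset.sum_congr rfl fun i _ => ?_
      rw [Finset.mul_sum]
      exact Finset.sum_congr rfl fun j _ => by ring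
    have h3 : ∀ f : ZMod d × ZMod d → ZMod d × ZMod d → ZMod d → ZMod d → ℂ,
        ∑ b, ∑ e, ∑ i, ∑ j, f i j b e = ∑ i, ∑ j, ∑ b, ∑ e, f i j b e := by
      intro f
      have h4 : ∀ g : ZMod d × ZMod d → ZMod d → ZMod d → ℂ,
          ∑ b, ∑ e, ∑ i, g i b e = ∑ i, ∑ b, ∑ e, g i b e := by
        intro g
        rw [Finset.sum_comm (s := (Finset.univ : Finset (ZMod d × ZMod d)))]
        exact Finset.sum_congr rfl fun a _ => Finset.sum_comm
      simp only [h4]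
    simp only [h2]
    rw [h3]
    have h5 : ∀ (x : ℂ) (f g : ZMod d → ℂ), ∑ b, ∑ e, x * (f b * g e) = x * ((∑ b, f b) * ∑ e, g e) := by
      intro x f g
      rw [Finset.sum_mul_sum, Finset.mul_sum]
      simp only [Finset.mul_sum]
    have hstar : ∀ x : ℝ, star (x : ℂ) = x := Complex.conj_ofReal
    simp only [h5, sum_bell_marginal]
    refine Finset.sum_congr rfl fun i _ => ?_
    rw [Finset.sum_eq_single (i + v)]
    · rw [if_pos rfl, sum_superposition_marginal, hstar]
      ring
    · intro j _ hj
      rw [if_neg hj]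
      ring
    · simp
  -- All Fourier coefficients at `w ≠ 0` vanish since the overlaps do not, so the function is
  -- constant and equals its value at `i = 0`.
  have hconst : ∀ v k i : ZMod d × ZMod d, v ≠ 0 → (schmidtWeight i * schmidtWeight (i + v) *
      (τ i (i + v) k - t k) * 𝐞 (i.2 * v.1) : ℂ) =
      schmidtWeight (0 : ZMod d × ZMod d) * schmidtWeight v * (τ 0 v k - t k) := by
    intro v k i hv
    have hg := eq_of_fourier_eq_zero (fun i => schmidtWeight i * schmidtWeight (i + v) *
      (τ i (i + v) k - t k) * 𝐞 ((i + v).2 * v.1)) (fun w hw => by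
        have h1 := hmarg v w k
        simp only [← mul_assoc, ← Finset.sum_mul] at h1
        simpa only [mul_assoc] using (mul_eq_zero.1 h1).resolve_right (h w v hw)) i
    have h2 : 𝐞 (v.2 * v.1) ≠ 0 := fun h0 => by
      have := AddChar.map_add_eq_mul 𝐞 (v.2 * v.1) (-(v.2 * v.1))
      rw [add_neg_cancel, AddChar.map_zero_eq_one, h0, zero_mul] at this
      exact one_ne_zero this
    simp only [zero_add, Prod.snd_add, add_mul, AddChar.map_add_eq_mul] at hg
    apply mul_right_cancel₀ h2
    linear_combination hg
  refine hS.eq_zero hω fun i j k => ?_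
  exact eq_zero_of_parallelogram_relation (τ := τ) (t := t)
    (fun i j k => FormPair.IsSchmidt.tri_comm hω _ _ _) (fun i k => hS.lin_eq hω i _)
    hconst ht i j k

end RigidExample

/-! ### Rigidity of almost every slice, and determination of the state. -/

/-- Rescaling `M` by `r` multiplies the constraints involving `M` by `r * star r` and leaves the
others alone, so a solution for `M` is one for `r • M`. -/
theorem FormPair.IsRigid.of_smul {κ : Type*} [Fintype κ] [DecidableEq κ]
    {M : Matrix (κ × κ) (κ × κ) ℂ} {r : ℂ} (h : IsRigid (r • M)) : IsRigid M := by
  intro w hw ht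
  refine h w (fun j => ?_) ht
  have hP : (r • M) * (r • M).conjTranspose = (r * star r) • (M * M.conjTranspose) := by
    rw [Matrix.conjTranspose_smul, Matrix.smul_mul, Matrix.mul_smul, smul_smul]
  rcases j with ⟨A, B, C⟩ | ⟨A, B, C⟩ | ⟨A, B, C⟩ | ⟨x, z, C⟩ | ⟨⟨b, b'⟩, ⟨e, e'⟩, C⟩
  · have h1 : w.1 (M * M.conjTranspose * A - A * (M * M.conjTranspose)) B C = 0 :=
      hw (Sum.inl (A, B, C))
    change w.1 ((r • M) * (r • M).conjTranspose * A - A * ((r • M) * (r • M).conjTranspose)) B C = 0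
    rw [hP, Matrix.smul_mul, Matrix.mul_smul, ← smul_sub, map_smul, LinearMap.smul_apply,
      LinearMap.smul_apply, h1, smul_zero]
  · have h1 : w.1 A (M * M.conjTranspose * B - B * (M * M.conjTranspose)) C = 0 :=
      hw (Sum.inr <| Sum.inl (A, B, C))
    change w.1 A ((r • M) * (r • M).conjTranspose * B - B * ((r • M) * (r • M).conjTranspose)) C = 0
    rw [hP, Matrix.smul_mul, Matrix.mul_smul, ← smul_sub, map_smul, LinearMap.smul_apply, h1,
      smul_zero]
  · exact hw (Sum.inr <| Sum.inr <| Sum.inl (A, B, C))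
  · exact hw (Sum.inr <| Sum.inr <| Sum.inr <| Sum.inl (x, z, C))
  · have h1 := hw (Sum.inr <| Sum.inr <| Sum.inr <| Sum.inr ((b, b'), (e, e'), C))
    simp only [constraint, Sum.elim_inr, evalTri_apply, evalLin_apply,
      LinearMap.sub_apply, LinearMap.sum_apply, LinearMap.smul_apply, smul_eq_mul] at h1 ⊢
    have h2 : ∀ c, (fun x => (r • M) x c) = r • fun x => M x c := fun c => rfl
    have h3 : ∀ c, (fun x => star ((r • M) x c)) = star r • fun x => star (M x c) := fun c => by
      funext x
      simp
    simp only [h2, h3, Matrix.smul_vecMulVec, Matrix.vecMulVec_smul, map_smul,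
      LinearMap.smul_apply, smul_eq_mul, ← Finset.mul_sum]
    have h4 : ∑ a, ∑ c, (r • M) (a, b) (c, e) * star ((r • M) (a, b') (c, e')) =
        r * star r * ∑ a, ∑ c, M (a, b) (c, e) * star (M (a, b') (c, e')) := by
      simp only [Finset.mul_sum]
      refine Finset.sum_congr rfl fun a _ => Finset.sum_congr rfl fun c _ => ?_
      simp only [Matrix.smul_apply, smul_eq_mul, star_mul']
      ring
    rw [h4]
    linear_combination (r * star r) * h1

theorem FormPair.ae_isRigid {E κ : Type*} [NormedAddCommGroup E] [NormedSpace ℝ E]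
    [FiniteDimensional ℝ E] [MeasurableSpace E] [BorelSpace E] (μ : Measure E)
    [μ.IsAddHaarMeasure] [Fintype κ] [DecidableEq κ]
    {M : E → Matrix (κ × κ) (κ × κ) ℂ} (hM : ∀ ψ x y, AnalyticAt ℝ (fun ψ => M ψ x y) ψ) {x₀ : E}
    (h₀ : IsRigid (M x₀)) : ∀ᵐ x ∂μ, IsRigid (M x) := by
  have h := ae_separating_of_separating μ (W := FormPair (κ × κ))
    -- The extra index `none` carries the normalisation `w.2 1 = 0`.
    (J := Option (ConstraintIndex κ))
    (fun x j => j.elim (evalLin 1) (constraint (M x))) ?_ x₀ ?_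
  · filter_upwards [h] with x hx w hw ht
    exact hx w fun j => by cases j <;> simp [hw, ht]
  · rintro (_ | j) w x -
    · exact analyticAt_const
    · exact analyticAt_constraint (hM x) j w
  · intro w hw
    exact h₀ w (fun j => hw (some j)) (hw none)

theorem samePureState_of_eq_smul {n d : ℕ} {φ ψ : PureState n d} {c : ℂ} (h : φ.1 = c • ψ.1) :
    SamePureState φ ψ := by
  have hφ : ‖φ.1‖ = 1 := mem_sphere_zero_iff_norm.1 φ.2
  have hψ : ‖ψ.1‖ = 1 := mem_sphere_zero_iff_norm.1 ψ.2
  have hc : ‖c‖ = 1 := by rw [h, norm_smul, hψ, mul_one] at hφ; exact hφ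
  refine ⟨c.arg, ?_⟩
  rw [h]
  congr 1
  have := Complex.norm_mul_exp_arg_mul_I c
  rw [hc, Complex.ofReal_one, one_mul] at this
  exact this.symm

section Slice

variable {n d : ℕ} {κ : Type*}

theorem setPair_comm {X : Type*} {A B C D : Fin n} (hAC : A ≠ C) (hAD : A ≠ D) (hBC : B ≠ C)
    (hBD : B ≠ D) (z : Fin n → X) (a b c e : X) :
    setPair C D (setPair A B z a b) c e = setPair A B (setPair C D z c e) a b := by
  funext r
  simp only [setPair, Function.update_apply]
  split_ifs <;> simp_all

theorem setPair_self {X : Type*} (A B : Fin n) (z : Fin n → X) : setPair A B z (z A) (z B) = z := by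
  by_cases h : A = B
  · subst h; simp [setPair]
  · simp [setPair]

/-- The amplitudes of the parties `A, B` and `C, D`, the other parties being in the levels `z`. -/
def slice (g : κ ≃ Fin d) (A B C D : Fin n) (z : Fin n → Fin d) (ψ : QuditSpace n d) :
    Matrix (κ × κ) (κ × κ) ℂ :=
  Matrix.of fun x y => ψ (setPair C D (setPair A B z (g x.1) (g x.2)) (g y.1) (g y.2))

theorem sum_setPair_equiv [Fintype κ] (g : κ ≃ Fin d) {φ ψ : PureState n d} {p q : Fin n}
    (hpq : p ≠ q)
    (h : marginal ({p, q} : Finset (Fin n))ᶜ (density φ) = marginal {p, q}ᶜ (density ψ))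
    (z z' : Fin n → Fin d) :
    ∑ x : κ × κ, φ.1 (setPair p q z (g x.1) (g x.2)) * star (φ.1 (setPair p q z' (g x.1) (g x.2))) =
      ∑ x : κ × κ, ψ.1 (setPair p q z (g x.1) (g x.2)) *
        star (ψ.1 (setPair p q z' (g x.1) (g x.2))) := by
  have key := sum_setPair_of_marginal_eq hpq h z z'
  rw [← (Equiv.prodCongr g g).sum_comp, ← (Equiv.prodCongr g g).sum_comp] at key
  exact key

theorem isDeterminedAmongPureBy_of_isRigid [Fintype κ] [DecidableEq κ] [Nonempty κ]
    (g : κ ≃ Fin d) {A B C D : Fin n} (hAB : A ≠ B) (hAC : A ≠ C) (hAD : A ≠ D) (hBC : B ≠ C)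
    (hBD : B ≠ D) (hCD : C ≠ D) (z : Fin n → Fin d) {ψ : PureState n d}
    (hR : FormPair.IsRigid (slice g A B C D z ψ.1)) :
    IsDeterminedAmongPureBy {({C, D} : Finset (Fin n))ᶜ, {A, B}ᶜ, {A, C}ᶜ} ψ := by
  intro φ hφ
  have hmCD := sum_setPair_equiv g hCD (hφ _ (by simp))
  have hmAB := sum_setPair_equiv g hAB (hφ _ (by simp))
  have hmAC := sum_setPair_equiv g hAC (hφ _ (by simp))
  -- The columns run over labels of all parties, the levels at `A, B` being overwritten. One `V`
  -- therefore serves every slice, and rigidity of the single slice at `z` makes it scalar for the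
  -- whole state.
  obtain ⟨V, hV, hVX⟩ := exists_unitary_mul_eq
    (Matrix.of fun (x : κ × κ) (y : Fin n → Fin d) => ψ.1 (setPair A B y (g x.1) (g x.2)))
    (Matrix.of fun (x : κ × κ) (y : Fin n → Fin d) => φ.1 (setPair A B y (g x.1) (g x.2))) (by
      ext y y'
      simp only [Matrix.mul_apply, Matrix.conjTranspose_apply, Matrix.of_apply]
      have := hmAB y' y
      simp only [mul_comm (star _)]
      exact this.symm)
  have hVφ : ∀ (y : Fin n → Fin d) (x : κ × κ), φ.1 (setPair A B y (g x.1) (g x.2)) =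
      ∑ x', V x x' * ψ.1 (setPair A B y (g x'.1) (g x'.2)) := fun y x =>
    congrFun (congrFun hVX x) y
  have hcomm := fun a b c e => setPair_comm hAC hAD hBC hBD z a b c e
  have hslice : slice g A B C D z φ.1 = V * slice g A B C D z ψ.1 := by
    ext x y
    simp only [slice, Matrix.of_apply, Matrix.mul_apply, hcomm]
    exact hVφ _ _
  have hPP : slice g A B C D z φ.1 * (slice g A B C D z φ.1).conjTranspose =
      slice g A B C D z ψ.1 * (slice g A B C D z ψ.1).conjTranspose := by
    ext x x'
    simp only [slice, Matrix.of_apply, Matrix.mul_apply, Matrix.conjTranspose_apply]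
    exact hmCD _ _
  obtain ⟨c, hc⟩ := hR.eq_smul_one hV (by
      rw [hslice, Matrix.conjTranspose_mul] at hPP
      conv_rhs => rw [← hPP]
      simp only [mul_assoc, hV, mul_one]) (by
      intro b b' e e'
      rw [← hslice]
      have hAC' : ∀ a b c e, setPair C D (setPair A B z a b) c e =
          setPair A C (setPair B D z b e) a c := by
        intro a b c e
        funext r
        simp only [setPair, Function.update_apply]
        split_ifs <;> simp_all
      simp only [slice, Matrix.of_apply, hAC', ← Fintype.sum_prod_type']
      exact hmAC _ _)
  refine samePureState_of_eq_smul (c := c) ?_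
  ext y
  have h1 := hVφ y (g.symm (y A), g.symm (y B))
  simp only [Equiv.apply_symm_apply, setPair_self] at h1
  rw [h1, hc, Finset.sum_eq_single (g.symm (y A), g.symm (y B))]
  · simp [setPair_self]
  · intro x' _ hx'
    simp [hx'.symm]
  · simp

end Slice

theorem ae_isDeterminedAmongPureBy {n d : ℕ} {A B C D : Fin n} (hAB : A ≠ B) (hAC : A ≠ C)
    (hAD : A ≠ D) (hBC : B ≠ C) (hBD : B ≠ D) (hCD : C ≠ D) :
    ∀ᵐ ψ ∂(haarPureState n d),
      IsDeterminedAmongPureBy {({C, D} : Finset (Fin n))ᶜ, {A, B}ᶜ, {A, C}ᶜ} ψ := by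
  -- For `d = 0` there are no unit vectors and for `d = 1` the space is a line; the example needs `d
  -- ≥ 2`.
  rcases Nat.lt_trichotomy d 1 with hd | rfl | hd
  · obtain rfl : d = 0 := by omega
    refine Filter.Eventually.of_forall fun ψ => ?_
    have h : ‖ψ.1‖ = 1 := mem_sphere_zero_iff_norm.1 ψ.2
    have h0 : ψ.1 = 0 := by ext y; exact (y A).elim0
    rw [h0, norm_zero] at h
    exact absurd h zero_ne_one
  · refine Filter.Eventually.of_forall fun ψ φ _ => ?_
    refine samePureState_of_eq_smul (c := φ.1 0 / ψ.1 0) ?_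
    have h : ψ.1 0 ≠ 0 := by
      intro h0
      have h1 : ψ.1 = 0 := by ext y; rw [Subsingleton.elim y 0, h0]; rfl
      have h2 : ‖ψ.1‖ = 1 := mem_sphere_zero_iff_norm.1 ψ.2
      rw [h1, norm_zero] at h2
      exact zero_ne_one h2
    ext y
    rw [Subsingleton.elim y 0, PiLp.smul_apply, smul_eq_mul, div_mul_cancel₀ _ h]
  · have : NeZero d := ⟨by omega⟩
    have : Fact (1 < d) := ⟨hd⟩
    let g : ZMod d ≃ Fin d := (ZMod.finEquiv d).symm.toEquiv
    let z : Fin n → Fin d := fun _ => g 0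
    obtain ⟨η, hη, hne⟩ := exists_weylOverlap_ne_zero (d := d)
    -- Neither normalised nor dependent on the remaining parties: one vector of the ambient space
    -- with a rigid slice is enough.
    let ψ₀ : QuditSpace n d := WithLp.toLp 2 fun y =>
      rigidTensor η (g.symm (y A), g.symm (y B)) (g.symm (y C), g.symm (y D))
    have hψ₀ : slice g A B C D z ψ₀ = rigidTensor η := by
      ext x y
      simp [slice, ψ₀, setPair, hAB, hAC, hAD, hBC, hBD, hCD]
    have hae : ∀ᵐ ψ ∂(Measure.addHaar : Measure (QuditSpace n d)),
        FormPair.IsRigid (slice g A B C D z ψ) := by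
      refine FormPair.ae_isRigid _ (x₀ := ψ₀) (fun ψ x y => ?_)
        (by rw [hψ₀]; exact isRigid_rigidTensor hη hne)
      exact ((EuclideanSpace.proj (𝕜 := ℂ)
        (setPair C D (setPair A B z (g x.1) (g x.2)) (g y.1) (g y.2))).restrictScalars
          ℝ).analyticAt ψ
    have hsphere := ae_toSphere_of_ae _ hae fun r ψ _ h => by
      have : slice g A B C D z (r • ψ) = (r : ℂ) • slice g A B C D z ψ := by
        ext x y
        simp [slice]
      rw [this] at h
      exact h.of_smul
    refine Measure.ae_smul_measure ?_ _
    filter_upwards [hsphere] with ψ hψ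
    exact isDeterminedAmongPureBy_of_isRigid g hAB hAC hAD hBC hBD hCD z hψ

/-- Here `{C, D}ᶜ` is the set of parties `A, B, E₁, …, E_{n-4}`, and likewise for the others. -/
theorem mainTheorem3 (n : ℕ) (hn : 4 ≤ n) (d : ℕ) (A B C D : Fin n) (hABCD : [A, B, C, D].Nodup) :
    (∀ᵐ ψ ∂(haarPureState n d),
      IsDeterminedAmongPureBy {({C, D} : Finset (Fin n))ᶜ, {A, B}ᶜ, {A, C}ᶜ} ψ) ∧
    (∀ᵐ ψ ∂(haarPureState n d), IsUDP (n - 2) ψ) := by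
  simp only [List.nodup_cons, List.mem_cons, List.not_mem_nil, or_false, not_or] at hABCD
  obtain ⟨⟨hAB, hAC, hAD⟩, ⟨hBC, hBD⟩, hCD, -⟩ := hABCD
  have h := ae_isDeterminedAmongPureBy (d := d) hAB hAC hAD hBC hBD hCD
  refine ⟨h, ?_⟩
  filter_upwards [h] with ψ hψ φ hφ
  have hcard : ∀ p q : Fin n, p ≠ q → (({p, q} : Finset (Fin n))ᶜ).card = n - 2 := by
    intro p q hpq
    rw [Finset.card_compl, Fintype.card_fin, Finset.card_pair hpq]
  refine hψ φ fun S hS => hφ S ?_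
  rcases hS with rfl | rfl | rfl
  · exact hcard C D hCD
  · exact hcard A B hAB
  · exact hcard A C hAC
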